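/- **Theorem 2.** Let $X_1,X_2,\ldots$ be independent copies of a random variable $X$ whose distribution function $F$ is continuous, with extremities $l_F=\inf\{x: F(x)>0\}$ and $r_F=\sup\{x: F(x)<1\}$. Let $L(1)=1$, $L(m)=\min\{j>L(m-1): X_j>X_{L(m-1)}\}$ for $m>1$, and let $X(m)=X_{L(m)}$ be the $m$-th upper record value. Conditional expectations given $X(i)=u$, $X(m)=v$ are means of the regular conditional distribution, and identities between them are understood for almost every $(u,v)$ with respect to the law of $(X(i),X(m))$. Consider the condition $$F(x)=1-e^{-c(x-l_F)}\quad (x\ge l_F)\qquad\text{for some constant } c>0,\ \text{ with } l_F>-\infty,\ r_F=\infty. \tag{E}$$ A. If $1\le k\le n-1$, then $$E[X(n)\mid X(n-k)=u,\ X(n+1)=v]=\frac{u+kv}{k+1}\qquad (l_F<u<v<r_F)$$ holds if and only if $X$ has the exponential distribution (E). B. If $r\ge 2$ and $2\le k\le n-1$, then both $$E[X(n)\mid X(n-k)=u,\ X(n+r)=v]=\frac{ru+kv}{k+r}\qquad (l_F<u<v<r_F)$$ and $$E[X(n)\mid X(n-k+1)=u_2,\ X(n+r)=v]=\frac{ru_2+(k-1)v}{r+k-1}\qquad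 (l_F<u_2<v<r_F)$$ hold if and only if $X$ has the exponential distribution (E). -/

import Mathlib

open MeasureTheory ProbabilityTheory

noncomputable section

/-- Upper record times of a sequence `x`, with positions and records counted from `0`:
`recordTime x 0 = 0`, and `recordTime x (m + 1)` is the first position after `recordTime x m`
whose entry exceeds the entry at `recordTime x m`. (If there is no such position the value is `0`;
for independent observations with a common continuous distribution function this has
probability zero.) -/
def recordTime (x : ℕ → ℝ) : ℕ → ℕ
  | 0 => 0
  | m + 1 => sInf {j : ℕ | recordTime x m < j ∧ x (recordTime x m) < x j}

/-- The `n`-th upper record value of the random sequence `X 0, X 1, …`, with records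
counted from `1`: the first record value is `X 0`. Only used for `1 ≤ n`. -/
def recordValue {Ω : Type*} (X : ℕ → Ω → ℝ) (n : ℕ) (ω : Ω) : ℝ :=
  X (recordTime (fun i => X i ω) (n - 1)) ω

/-- Left extremity `inf {x | F x > 0}` of the distribution function `F` of `ν`. -/
def leftExtremity (ν : Measure ℝ) : EReal :=
  sInf {y : EReal | ∃ x : ℝ, y = (x : EReal) ∧ 0 < cdf ν x}

/-- Right extremity `sup {x | F x < 1}` of the distribution function `F` of `ν`. -/
def rightExtremity (ν : Measure ℝ) : EReal :=
  sSup {y : EReal | ∃ x : ℝ, y = (x : EReal) ∧ cdf ν x < 1}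

/-- `F x = 1 - exp (-c (x - l))` for `x ≥ l`, where the left extremity `l` is finite, the right
extremity is `∞`, and `c > 0` is some constant. -/
def IsShiftedExponential (ν : Measure ℝ) : Prop :=
  ∃ l : ℝ, leftExtremity ν = (l : EReal) ∧ rightExtremity ν = ⊤ ∧
    ∃ c : ℝ, 0 < c ∧ ∀ x : ℝ, l ≤ x → cdf ν x = 1 - Real.exp (-c * (x - l))

/-- Regular conditional distribution of `X(n)` given `X(i) = u` and `X(m) = v`, as a kernel
in `(u, v)`. -/
def recordCondLaw {Ω : Type*} [MeasurableSpace Ω] (μ : Measure Ω) [IsProbabilityMeasure μ]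
    (X : ℕ → Ω → ℝ) (n i m : ℕ) : Kernel (ℝ × ℝ) ℝ :=
  condDistrib (recordValue X n) (fun ω => (recordValue X i ω, recordValue X m ω)) μ

/-- `E[X(n) | X(i) = u, X(m) = v] = φ u v` for `l < u < v < r`, where `l` and `r` are the
extremities of the common law `ν` of the observations. A conditional expectation given
`X(i) = u, X(m) = v` is determined up to null sets of the joint law of `(X(i), X(m))`, so the
identity is required for almost every `(u, v)` under that law. It is taken as the mean of the
regular conditional distribution, since `X(n)` itself need not be integrable. -/
def RecordRegression {Ω : Type*} [MeasurableSpace Ω] (μ : Measure Ω) [IsProbabilityMeasure μ]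
    (X : ℕ → Ω → ℝ) (ν : Measure ℝ) (n i m : ℕ) (φ : ℝ → ℝ → ℝ) : Prop :=
  ∀ᵐ p ∂(μ.map (fun ω => (recordValue X i ω, recordValue X m ω))),
    leftExtremity ν < (p.1 : EReal) → p.1 < p.2 → (p.2 : EReal) < rightExtremity ν →
      Integrable (fun t : ℝ => t) (recordCondLaw μ X n i m p) ∧
        ∫ t, t ∂(recordCondLaw μ X n i m p) = φ p.1 p.2

end

open scoped ENNReal

/-! Let `Q s` be the quantile of order `1 - exp (-s)`. Then `X` has the law of `Q E` with `E`
standard exponential, and since `Q` is strictly increasing on `(0, ∞)`, the records of `X` are the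
images under `Q` of the records of an exponential sequence. By memorylessness the latter are partial
sums of independent standard exponentials. Beta-gamma algebra (`lintegral_gammaMeasure_add`) then
describes a record lying `k` steps after `Q a` and `r` steps before `Q (a + T)`: given these two
values, it is distributed as `Q (a + T * u)` with `u` of law beta `(k, r)`.

Hence (`recordRegression_iff`) the regression condition is equivalent to the equation, for almost
all `a, T > 0`, that the beta mean of `Q (a + T * u)` is `(r * Q a + k * Q (a + T)) / (k + r)`.
Since `F` is shifted exponential iff `Q` is affine (`isShiftedExponential_iff`), it remains to show
that the monotone solutions are the affine functions. Affine functions are solutions because the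
beta law has mean `k / (k + r)`.

Conversely, for `r = 1` fix `a`: with `g t = Q (a + t) - Q a`, the primitive `Ψ` of `s ^ (k - 1) * g
s` satisfies `t Ψ' = (k + 1) Ψ`, so it is a multiple of `t ^ (k + 1)` and `g` is linear. For general
`r` fix the right endpoint `b`, and put `p y = Q b - Q (b - y)` and `I j t = ∫ (t - y) ^ j * y ^ (r
- 1) * p y` over `(0, t)`. The two regressions express `I (k - 1)` and `I (k - 2)` through `p`.
Eliminating `p`, and using that `I (k - 1)` has derivative `(k - 1) * I (k - 2)`, gives the same
kind of equation. Monotonicity of `Q` turns almost everywhere identities into identities everywhere.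
-/

/-! ### Gamma and beta laws -/

lemma lintegral_comp_const_mul {c : ℝ} (hc : 0 < c) {f : ℝ → ℝ≥0∞} (hf : Measurable f) :
    ∫⁻ x, f x = ENNReal.ofReal c * ∫⁻ x, f (c * x) := by
  have h := congrArg (fun m => ∫⁻ x, f x ∂m) (Real.map_volume_mul_left hc.ne')
  simp only [lintegral_smul_measure] at h
  rw [lintegral_map hf (by fun_prop)] at h
  rw [h, smul_eq_mul, ← mul_assoc, ← ENNReal.ofReal_mul hc.le, abs_of_pos (inv_pos.2 hc),
    mul_inv_cancel₀ hc.ne', ENNReal.ofReal_one, one_mul]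

@[fun_prop]
lemma measurable_gammaPDF (a r : ℝ) : Measurable (gammaPDF a r) :=
  (measurable_gammaPDFReal a r).ennreal_ofReal

@[fun_prop]
lemma measurable_betaPDF (a b : ℝ) : Measurable (betaPDF a b) :=
  (measurable_betaPDFReal a b).ennreal_ofReal

lemma lintegral_gammaMeasure (a r : ℝ) {f : ℝ → ℝ≥0∞} (hf : Measurable f) :
    ∫⁻ x, f x ∂gammaMeasure a r = ∫⁻ x, gammaPDF a r x * f x := by
  rw [gammaMeasure, lintegral_withDensity_eq_lintegral_mul _ (by fun_prop) hf]
  rfl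

lemma lintegral_betaMeasure (a b : ℝ) {f : ℝ → ℝ≥0∞} (hf : Measurable f) :
    ∫⁻ x, f x ∂betaMeasure a b = ∫⁻ x, betaPDF a b x * f x := by
  rw [betaMeasure, lintegral_withDensity_eq_lintegral_mul _ (by fun_prop) hf]
  rfl

/-- The substitution `s = T * x` has Jacobian `T` and separates the product of the two gamma
densities into a function of `T` and a function of `x`. -/
lemma gammaPDFReal_mul_gammaPDFReal {a b r : ℝ} (ha : 0 < a) (hb : 0 < b) (hr : 0 < r)
    {T x : ℝ} (hT : 0 < T) (hx : x ∈ Set.Ioo (0 : ℝ) 1) :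
    T * (gammaPDFReal a r (T * x) * gammaPDFReal b r (T - T * x)) =
      gammaPDFReal (a + b) r T * betaPDFReal a b x := by
  obtain ⟨h0, h1⟩ := hx
  have h2 : T - T * x = T * (1 - x) := by ring
  have h3 : 0 < 1 - x := by linarith
  rw [gammaPDFReal, gammaPDFReal, gammaPDFReal, betaPDFReal, if_pos (by positivity),
    if_pos (by rw [h2]; positivity), if_pos hT.le, if_pos ⟨h0, h1⟩, h2,
    Real.mul_rpow hT.le h0.le, Real.mul_rpow hT.le h3.le, beta, Real.rpow_add hr]
  have h4 : T ^ (a + b - 1) = T * (T ^ (a - 1) * T ^ (b - 1)) := by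
    rw [← Real.rpow_add hT, mul_comm, ← Real.rpow_add_one hT.ne']
    congr 1; ring
  have h5 : Real.exp (-(r * T)) = Real.exp (-(r * (T * x))) * Real.exp (-(r * (T * (1 - x)))) := by
    rw [← Real.exp_add]; congr 1; ring
  have := (Real.Gamma_pos_of_pos ha).ne'
  have := (Real.Gamma_pos_of_pos hb).ne'
  have := (Real.Gamma_pos_of_pos (add_pos ha hb)).ne'
  rw [h4, h5]
  field_simp

/-- Beta-gamma algebra: if `S` and `T` are independent gamma variables of shapes `a` and `b`, then
`S + T` is gamma of shape `a + b`, and is independent of `S / (S + T)`, which is beta. -/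
lemma lintegral_gammaMeasure_add {a b r : ℝ} (ha : 0 < a) (hb : 0 < b) (hr : 0 < r)
    {g : ℝ → ℝ → ℝ≥0∞} (hg : Measurable (Function.uncurry g)) :
    ∫⁻ s, ∫⁻ t, g s (s + t) ∂gammaMeasure b r ∂gammaMeasure a r =
      ∫⁻ T, ∫⁻ x, g (T * x) T ∂betaMeasure a b ∂gammaMeasure (a + b) r := by
  have hp := gammaPDFReal_nonneg ha hr
  have hg2 : ∀ {u v : ℝ × ℝ → ℝ}, Measurable u → Measurable v →
      Measurable fun p => g (u p) (v p) := fun hu hv => hg.comp (hu.prodMk hv)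
  have hg1 : ∀ {u v : ℝ → ℝ}, Measurable u → Measurable v →
      Measurable fun p => g (u p) (v p) := fun hu hv => hg.comp (hu.prodMk hv)
  have : IsProbabilityMeasure (gammaMeasure b r) := isProbabilityMeasure_gammaMeasure hb hr
  have : IsProbabilityMeasure (betaMeasure a b) := isProbabilityMeasureBeta ha hb
  have hL : ∫⁻ s, ∫⁻ t, g s (s + t) ∂gammaMeasure b r ∂gammaMeasure a r =
      ∫⁻ T, ∫⁻ s, gammaPDF a r s * (gammaPDF b r (T - s) * g s T) := by
    rw [lintegral_gammaMeasure _ _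
      (Measurable.lintegral_prod_right' (f := fun p : ℝ × ℝ => g p.1 (p.1 + p.2))
        (hg2 (by fun_prop) (by fun_prop))), lintegral_lintegral_swap]
    · refine lintegral_congr fun s => ?_
      have := hg1 (measurable_const (a := s)) measurable_id
      simp only [id] at this
      rw [lintegral_const_mul _ (by fun_prop),
        lintegral_gammaMeasure _ _ (hg1 (by fun_prop) (by fun_prop)),
        ← lintegral_sub_right_eq_self _ s]
      simp
    · have := hg2 measurable_snd measurable_fst
      simp only [Function.uncurry_def]
      fun_prop
  rw [hL, lintegral_gammaMeasure _ _
    (Measurable.lintegral_prod_right' (f := fun p : ℝ × ℝ => g (p.1 * p.2) p.1)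
      (hg2 (by fun_prop) (by fun_prop)))]
  refine lintegral_congr_ae ?_
  filter_upwards [compl_mem_ae_iff.2 (measure_singleton (0 : ℝ))] with T hT
  rcases lt_or_gt_of_ne (show T ≠ 0 from hT) with hT | hT
  · rw [gammaPDF_of_neg hT, zero_mul]
    refine (lintegral_congr fun s => ?_).trans lintegral_zero
    rcases lt_or_ge s 0 with h | h
    · rw [gammaPDF_of_neg h, zero_mul]
    · rw [gammaPDF_of_neg (by linarith : T - s < 0), zero_mul, mul_zero]
  · have h1 := hg1 measurable_id (measurable_const (a := T))
    have h2 := hg1 (u := fun x => T * x) (by fun_prop) (measurable_const (a := T))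
    simp only [id] at h1
    rw [lintegral_comp_const_mul hT (by fun_prop), lintegral_betaMeasure _ _ h2,
      ← lintegral_const_mul _ (by fun_prop),
      ← lintegral_const_mul (f := fun x => betaPDF a b x * g (T * x) T) _
        ((measurable_betaPDF a b).mul h2)]
    refine lintegral_congr_ae ?_
    filter_upwards [compl_mem_ae_iff.2 (measure_singleton (0 : ℝ)),
      compl_mem_ae_iff.2 (measure_singleton (1 : ℝ))] with x hx0 hx1
    by_cases hx : x ∈ Set.Ioo (0 : ℝ) 1
    · rw [← mul_assoc, ← mul_assoc, ← mul_assoc]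
      congr 1
      rw [gammaPDF, gammaPDF, gammaPDF, betaPDF, ← ENNReal.ofReal_mul hT.le,
        ← ENNReal.ofReal_mul (mul_nonneg hT.le (hp _)),
        ← ENNReal.ofReal_mul (gammaPDFReal_nonneg (add_pos ha hb) hr _), mul_assoc,
        gammaPDFReal_mul_gammaPDFReal ha hb hr hT hx]
    · rcases lt_or_gt_of_ne (show x ≠ 0 from hx0) with h | h
      · rw [gammaPDF_of_neg (mul_neg_of_pos_of_neg hT h), betaPDF_eq_zero_of_nonpos h.le]
        simp
      · have h1 : 1 < x := lt_of_le_of_ne (not_lt.1 fun h' => hx ⟨h, h'⟩) (Ne.symm hx1)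
        rw [gammaPDF_of_neg (show T - T * x < 0 by nlinarith), betaPDF_eq_zero_of_one_le h1.le]
        simp

lemma lintegral_gammaMeasure_add_right {a b r : ℝ} (ha : 0 < a) (hb : 0 < b) (hr : 0 < r)
    {g : ℝ → ℝ≥0∞} (hg : Measurable g) :
    ∫⁻ s, ∫⁻ t, g (s + t) ∂gammaMeasure b r ∂gammaMeasure a r =
      ∫⁻ T, g T ∂gammaMeasure (a + b) r := by
  have := isProbabilityMeasureBeta ha hb
  rw [lintegral_gammaMeasure_add ha hb hr (g := fun _ y => g y) (hg.comp measurable_snd)]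
  simp

/-! ### Deterministic record sequences and their measurability -/

/-- The sequence `z, w 0, w 1, …`. -/
def consSeq (z : ℝ) (w : ℕ → ℝ) : ℕ → ℝ
  | 0 => z
  | n + 1 => w n

@[simp] lemma consSeq_zero (z : ℝ) (w : ℕ → ℝ) : consSeq z w 0 = z := rfl

@[simp] lemma consSeq_succ (z : ℝ) (w : ℕ → ℝ) (n : ℕ) : consSeq z w (n + 1) = w n := rfl

/-- The sequence of record values of `x`, counted from `0`. -/
noncomputable def recordSeq (x : ℕ → ℝ) (m : ℕ) : ℝ := x (recordTime x m)

/-- The sequence `x` from its second record on. -/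
noncomputable def nextRecordShift (x : ℕ → ℝ) (j : ℕ) : ℝ := x (recordTime x 1 + j)

lemma recordTime_succ (x : ℕ → ℝ) (m : ℕ) :
    recordTime x (m + 1) = sInf {j : ℕ | recordTime x m < j ∧ x (recordTime x m) < x j} := rfl

@[simp] lemma recordSeq_zero (x : ℕ → ℝ) : recordSeq x 0 = x 0 := rfl

@[fun_prop]
lemma measurable_consSeq : Measurable fun p : ℝ × (ℕ → ℝ) => consSeq p.1 p.2 := by
  refine measurable_pi_lambda _ fun i => ?_
  cases i with
  | zero => exact measurable_fst
  | succ i => exact (measurable_pi_apply i).comp measurable_snd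

lemma measurable_nat_sInf {α : Type*} [MeasurableSpace α] {A : α → Set ℕ}
    (hA : ∀ k, MeasurableSet {x | k ∈ A x}) : Measurable fun x => sInf (A x) := by
  refine measurable_to_countable' fun k => ?_
  -- The second set accounts for the convention `sInf ∅ = 0`.
  have h : (fun x => sInf (A x)) ⁻¹' {k} =
      ({x | k ∈ A x} ∩ ⋂ j, ⋂ (_ : j < k), {x | j ∈ A x}ᶜ) ∪
        ({_x | k = 0} ∩ ⋂ j, {x | j ∈ A x}ᶜ) := by
    ext x
    simp only [Set.mem_preimage, Set.mem_singleton_iff, Set.mem_union, Set.mem_inter_iff,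
      Set.mem_ofPred_eq, Set.mem_iInter, Set.mem_compl_iff]
    constructor
    · rintro rfl
      rcases (A x).eq_empty_or_nonempty with h | h
      · right; simp [h]
      · exact Or.inl ⟨Nat.sInf_mem h, fun j hj => Nat.notMem_of_lt_sInf hj⟩
    · rintro (⟨h1, h2⟩ | ⟨rfl, h⟩)
      · exact le_antisymm (Nat.sInf_le h1)
          (not_lt.1 fun hlt => h2 _ hlt (Nat.sInf_mem ⟨k, h1⟩))
      · rw [Set.eq_empty_of_forall_notMem h, Nat.sInf_empty]
  rw [h]
  refine ((hA k).inter (.iInter fun j => .iInter fun _ => (hA j).compl)).union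
    (MeasurableSet.inter (.const _) (.iInter fun j => (hA j).compl))

lemma measurable_apply_index {α : Type*} [MeasurableSpace α] {X : ℕ → α → ℝ} {T : α → ℕ}
    (hX : ∀ i, Measurable (X i)) (hT : Measurable T) : Measurable fun x => X (T x) x := by
  have h : Measurable fun p : ℕ × α => X p.1 p.2 := measurable_from_prod_countable_right hX
  exact h.comp (hT.prodMk measurable_id)

@[fun_prop]
lemma measurable_recordTime (m : ℕ) : Measurable fun x => recordTime x m := by
  induction m with
  | zero => exact measurable_const
  | succ m ih =>
    simp only [recordTime_succ]
    refine measurable_nat_sInf fun k => ?_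
    exact (measurableSet_lt ih measurable_const).inter
      (measurableSet_lt (measurable_apply_index measurable_pi_apply ih) (measurable_pi_apply k))

@[fun_prop]
lemma measurable_recordSeq : Measurable recordSeq :=
  measurable_pi_lambda _ fun m =>
    measurable_apply_index measurable_pi_apply (measurable_recordTime m)

@[fun_prop]
lemma measurable_nextRecordShift : Measurable nextRecordShift :=
  measurable_pi_lambda _ fun j =>
    measurable_apply_index (X := fun i x => x (i + j)) (fun i => measurable_pi_apply (i + j))
      (measurable_recordTime 1)

lemma sInf_image_add (c : ℕ) {A B : Set ℕ} (h : ∀ j, c + j ∈ B ↔ j ∈ A)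
    (hB : ∀ j ∈ B, c ≤ j) (hne : B.Nonempty) : sInf B = c + sInf A := by
  obtain ⟨b, hb⟩ := hne
  have hA : A.Nonempty := ⟨b - c, by rw [← h]; rwa [Nat.add_sub_cancel' (hB b hb)]⟩
  refine le_antisymm (Nat.sInf_le ((h _).2 (Nat.sInf_mem hA))) ?_
  have h1 := Nat.sInf_mem ⟨b, hb⟩
  have h2 := hB _ h1
  have h3 : sInf B - c ∈ A := by rw [← h]; rwa [Nat.add_sub_cancel' h2]
  have := Nat.sInf_le h3
  omega

/-- Everything before the second record is at most the first record, so the search for later records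
can restart there. The hypothesis excludes the default value of `sInf ∅`. -/
lemma recordTime_succ_eq_add {x : ℕ → ℝ} (hx : ∀ i, ∃ j, i < j ∧ x i < x j) (m : ℕ) :
    recordTime x (m + 1) = recordTime x 1 + recordTime (nextRecordShift x) m := by
  induction m with
  | zero => simp [recordTime]
  | succ m ih =>
    rw [recordTime_succ x (m + 1), ih, recordTime_succ (nextRecordShift x) m]
    refine sInf_image_add _ (fun j => ?_) (fun j hj => ?_) (hx _)
    · simp [nextRecordShift]
    · exact le_trans (Nat.le_add_right _ _) hj.1.le

lemma recordSeq_succ {x : ℕ → ℝ} (hx : ∀ i, ∃ j, i < j ∧ x i < x j) (m : ℕ) :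
    recordSeq x (m + 1) = recordSeq (nextRecordShift x) m := by
  rw [recordSeq, recordTime_succ_eq_add hx]
  rfl

lemma nextRecordShift_cons_of_lt {z y : ℝ} (h : z < y) (w : ℕ → ℝ) :
    nextRecordShift (consSeq z (consSeq y w)) = consSeq y w := by
  have h1 : recordTime (consSeq z (consSeq y w)) 1 = 1 := by
    have hm : (1 : ℕ) ∈ {j : ℕ | recordTime (consSeq z (consSeq y w)) 0 < j ∧
        consSeq z (consSeq y w) (recordTime (consSeq z (consSeq y w)) 0) <
          consSeq z (consSeq y w) j} := ⟨Nat.one_pos, h⟩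
    exact le_antisymm (Nat.sInf_le hm) (Nat.sInf_mem ⟨_, hm⟩).1
  funext j
  rw [nextRecordShift, h1, add_comm, consSeq_succ]

/-- An observation not exceeding the current record can be deleted without affecting what follows
the next record. -/
lemma nextRecordShift_cons_of_le {z y : ℝ} (h : y ≤ z) {w : ℕ → ℝ} (hw : ∃ j, z < w j) :
    nextRecordShift (consSeq z (consSeq y w)) = nextRecordShift (consSeq z w) := by
  obtain ⟨j₀, hj₀⟩ := hw
  have h0 : ∀ x, recordTime x 0 = 0 := fun _ => rfl
  have hne : {j : ℕ | 0 < j ∧ z < consSeq z w j}.Nonempty := ⟨j₀ + 1, Nat.succ_pos _, hj₀⟩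
  have h1 : recordTime (consSeq z (consSeq y w)) 1 = 1 + recordTime (consSeq z w) 1 := by
    rw [recordTime_succ, recordTime_succ]
    simp only [h0, consSeq_zero]
    refine sInf_image_add _ (fun j => ?_) (fun j hj => hj.1) ⟨j₀ + 2, Nat.succ_pos _, hj₀⟩
    rw [add_comm 1 j]
    rcases j with _ | j
    · simp [h]
    · simp
  have h2 : 0 < recordTime (consSeq z w) 1 := (Nat.sInf_mem hne).1
  obtain ⟨L, hL⟩ := Nat.exists_eq_succ_of_ne_zero h2.ne'
  funext j
  rw [nextRecordShift, nextRecordShift, h1, hL]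
  have e1 : 1 + L.succ + j = (L + j) + 1 + 1 := by omega
  have e2 : L.succ + j = (L + j) + 1 := by omega
  rw [e1, e2]
  simp

/-! ### Sequences of independent observations -/

section Product

variable (ν : Measure ℝ) [IsProbabilityMeasure ν]

/-- Law of a sequence of independent observations from `ν`. -/
noncomputable abbrev iidLaw : Measure (ℕ → ℝ) := Measure.infinitePi fun _ => ν

lemma map_consSeq_prod : (ν.prod (iidLaw ν)).map (fun p => consSeq p.1 p.2) = iidLaw ν := by
  classical
  refine Measure.eq_infinitePi _ fun s t ht => ?_
  set u : ℕ → Set ℝ := fun i => if i ∈ s then t i else Set.univ with hu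
  have hum : ∀ i, MeasurableSet (u i) := fun i => by
    simp only [hu]; split_ifs <;> simp [ht]
  obtain ⟨N, hN⟩ := s.exists_nat_subset_range
  have hpre : (fun p : ℝ × (ℕ → ℝ) => consSeq p.1 p.2) ⁻¹' (Set.pi s t) =
      u 0 ×ˢ Set.pi (Finset.range N) fun i => u (i + 1) := by
    ext ⟨z, w⟩
    simp only [Set.mem_preimage, Set.mem_pi, Set.mem_prod, Finset.coe_range, Set.mem_Iio, hu,
      Finset.mem_coe]
    constructor
    · intro h
      refine ⟨?_, fun i _ => ?_⟩
      · split_ifs with h0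
        · exact h 0 h0
        · trivial
      · split_ifs with h0
        · exact h _ h0
        · trivial
    · rintro ⟨h1, h2⟩ i hi
      rcases i with _ | i
      · simpa [hi] using h1
      · have := h2 i (by have := Finset.mem_range.1 (hN hi); omega)
        simpa [hi] using this
  rw [Measure.map_apply measurable_consSeq (.pi s.countable_toSet fun _ _ => ht _), hpre,
    Measure.prod_prod, Measure.infinitePi_pi _ fun i _ => hum _, mul_comm,
    ← Finset.prod_range_succ' (fun i => ν (u i))]
  have hs : s ⊆ Finset.range (N + 1) :=
    hN.trans (Finset.range_subset_range.2 (Nat.le_succ N))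
  rw [← Finset.prod_subset hs fun i _ hi => by simp [hu, hi]]
  exact Finset.prod_congr rfl fun i hi => by simp [hu, hi]

lemma lintegral_iidLaw_cons {f : (ℕ → ℝ) → ℝ≥0∞} (hf : Measurable f) :
    ∫⁻ x, f x ∂iidLaw ν = ∫⁻ z, ∫⁻ w, f (consSeq z w) ∂iidLaw ν ∂ν := by
  conv_lhs => rw [← map_consSeq_prod ν]
  rw [lintegral_map hf measurable_consSeq, lintegral_prod _ (by fun_prop)]

/-- The probability that `M` consecutive observations stay at or below `c` is the `M`-th power of a
number less than `1`. -/
lemma ae_iidLaw_exists_lt {c : ℝ} (hc : ν (Set.Iic c) < 1) (N : ℕ) :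
    ∀ᵐ w ∂iidLaw ν, ∃ j, N ≤ j ∧ c < w j := by
  rw [ae_iff]
  push Not
  refine le_antisymm ?_ zero_le
  refine ge_of_tendsto' (ENNReal.tendsto_pow_atTop_nhds_zero_of_lt_one hc) fun M => ?_
  calc iidLaw ν {w | ∀ j, N ≤ j → w j ≤ c}
      ≤ iidLaw ν (Set.pi (Finset.Ico N (N + M)) fun _ => Set.Iic c) :=
        measure_mono fun w hw j hj => hw j (Finset.mem_Ico.1 hj).1
    _ = ν (Set.Iic c) ^ M := by
        rw [Measure.infinitePi_pi _ fun _ _ => measurableSet_Iic]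
        simp

end Product

/-! ### Records of an exponential sequence -/

instance : IsProbabilityMeasure (expMeasure 1) := isProbabilityMeasure_expMeasure one_pos

lemma expMeasure_Iic {z : ℝ} (hz : 0 ≤ z) :
    expMeasure 1 (Set.Iic z) = ENNReal.ofReal (1 - Real.exp (-z)) := by
  rw [← ofReal_cdf, cdf_expMeasure_eq one_pos, if_pos hz, one_mul]

lemma gammaMeasure_Iic_zero (a r : ℝ) : gammaMeasure a r (Set.Iic 0) = 0 := by
  rw [gammaMeasure, withDensity_apply _ measurableSet_Iic, ← setLIntegral_congr Iio_ae_eq_Iic,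
    lintegral_gammaPDF_of_nonpos le_rfl]

lemma ae_gammaMeasure_pos (a r : ℝ) : ∀ᵐ t ∂gammaMeasure a r, 0 < t := by
  rw [ae_iff]
  simp only [not_lt]
  exact gammaMeasure_Iic_zero a r

/-- The exponential distribution is memoryless. -/
lemma setLIntegral_expMeasure_Ioi {z : ℝ} (hz : 0 ≤ z) {f : ℝ → ℝ≥0∞} (hf : Measurable f) :
    ∫⁻ y in Set.Ioi z, f y ∂expMeasure 1 =
      ENNReal.ofReal (Real.exp (-z)) * ∫⁻ t, f (z + t) ∂expMeasure 1 := by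
  rw [← lintegral_indicator measurableSet_Ioi, expMeasure,
    lintegral_gammaMeasure _ _ (hf.indicator measurableSet_Ioi),
    lintegral_gammaMeasure _ _ (by fun_prop), ← lintegral_const_mul _ (by fun_prop),
    ← lintegral_add_left_eq_self _ z]
  refine lintegral_congr_ae ?_
  filter_upwards [compl_mem_ae_iff.2 (measure_singleton (0 : ℝ))] with t ht
  rcases lt_or_gt_of_ne (show t ≠ 0 from ht) with h | h
  · rw [gammaPDF_of_neg h, Set.indicator_of_notMem (by simp [h.le])]
    simp
  · rw [Set.indicator_of_mem (by simpa using h), ← mul_assoc, gammaPDF_of_nonneg h.le,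
      gammaPDF_of_nonneg (by linarith), ← ENNReal.ofReal_mul (Real.exp_nonneg _)]
    congr 2
    simp [Real.exp_add]
    ring

/-- Solves the equation obtained by conditioning on the next observation; finiteness of `x` permits
the cancellation. -/
lemma ENNReal.eq_of_eq_ofReal_mul_add {p q : ℝ} (hp : 0 < p) (hq : 0 ≤ q) (hpq : p + q = 1)
    {x y : ℝ≥0∞} (hx : x ≠ ∞) (h : x = ENNReal.ofReal p * y + ENNReal.ofReal q * x) : x = y := by
  have h1 : ENNReal.ofReal p * x + ENNReal.ofReal q * x = x := by
    rw [← add_mul, ← ENNReal.ofReal_add hp.le hq, hpq, ENNReal.ofReal_one, one_mul]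
  have h2 : ENNReal.ofReal p * x = ENNReal.ofReal p * y :=
    (ENNReal.add_left_inj (ENNReal.mul_ne_top ENNReal.ofReal_ne_top hx)).1 (h1.trans h)
  exact (ENNReal.mul_right_inj (by simpa using hp) ENNReal.ofReal_ne_top).1 h2

lemma expMeasure_Iic_lt_one (c : ℝ) : expMeasure 1 (Set.Iic c) < 1 := by
  rcases le_total 0 c with h | h
  · rw [expMeasure_Iic h, ENNReal.ofReal_lt_one]
    linarith [Real.exp_pos (-c)]
  · refine (measure_mono (Set.Iic_subset_Iic.2 h)).trans_lt ?_
    rw [expMeasure, gammaMeasure_Iic_zero]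
    exact one_pos

lemma ae_exists_lt_of_expMeasure :
    ∀ᵐ w ∂iidLaw (expMeasure 1), ∀ (c : ℝ) (N : ℕ), ∃ j, N ≤ j ∧ c < w j := by
  have h : ∀ᵐ w ∂iidLaw (expMeasure 1), ∀ c N : ℕ, ∃ j, N ≤ j ∧ (c : ℝ) < w j :=
    ae_all_iff.2 fun c => ae_all_iff.2 fun N => ae_iidLaw_exists_lt _ (expMeasure_Iic_lt_one _) N
  filter_upwards [h] with w hw c N
  obtain ⟨m, hm⟩ := exists_nat_gt c
  obtain ⟨j, hj, hj'⟩ := hw m N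
  exact ⟨j, hj, hm.trans hj'⟩

/-- From its second record on, the sequence `z, w 0, w 1, …` is distributed like
`z + t, w 0, w 1, …` with `t` exponential and independent of `w`. -/
lemma map_nextRecordShift_consSeq {z : ℝ} (hz : 0 ≤ z) :
    (iidLaw (expMeasure 1)).map (fun w => nextRecordShift (consSeq z w)) =
      ((expMeasure 1).prod (iidLaw (expMeasure 1))).map (fun p => consSeq (z + p.1) p.2) := by
  have hmS : Measurable fun w => nextRecordShift (consSeq z w) := by fun_prop
  ext B hB
  set Φ := (iidLaw (expMeasure 1)).map (fun w => nextRecordShift (consSeq z w)) B with hΦ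
  have hmB : Measurable (B.indicator (1 : (ℕ → ℝ) → ℝ≥0∞)) := measurable_one.indicator hB
  have hΦ' : Φ = ∫⁻ w, B.indicator 1 (nextRecordShift (consSeq z w)) ∂iidLaw (expMeasure 1) := by
    rw [hΦ, ← lintegral_indicator_one hB, lintegral_map hmB hmS]
  have hm2 : Measurable fun y => ∫⁻ w, B.indicator (1 : (ℕ → ℝ) → ℝ≥0∞) (consSeq y w)
      ∂iidLaw (expMeasure 1) :=
    Measurable.lintegral_prod_right' (hmB.comp measurable_consSeq)
  rw [← lintegral_indicator_one hB, lintegral_map hmB (by fun_prop),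
    lintegral_prod _ (by fun_prop)]
  -- Condition on the observation `y` following `z`. If `y > z`, with probability `exp (-z)`,
  -- memorylessness gives the claimed law; otherwise `y` is deleted and the situation is the
  -- original one. This yields a fixed-point equation for `Φ`.
  refine ENNReal.eq_of_eq_ofReal_mul_add (Real.exp_pos (-z)) (q := 1 - Real.exp (-z))
    (by simpa using hz) (by ring) ?_ ?_
  · rw [hΦ, Measure.map_apply hmS hB]
    exact measure_ne_top _ _
  · rw [← setLIntegral_expMeasure_Ioi hz hm2]
    conv_lhs => rw [hΦ', lintegral_iidLaw_cons _ (by fun_prop),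
      ← lintegral_add_compl _ (measurableSet_Ioi (a := z)), Set.compl_Ioi]
    congr 1
    · refine setLIntegral_congr_fun measurableSet_Ioi fun y hy => ?_
      exact lintegral_congr fun w => by rw [nextRecordShift_cons_of_lt hy]
    · rw [← expMeasure_Iic hz, mul_comm, ← setLIntegral_const]
      refine setLIntegral_congr_fun measurableSet_Iic fun y hy => ?_
      rw [hΦ']
      refine lintegral_congr_ae ?_
      filter_upwards [ae_exists_lt_of_expMeasure] with w hw
      obtain ⟨j, -, hj⟩ := hw z 0
      rw [nextRecordShift_cons_of_le hy ⟨j, hj⟩]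

lemma lintegral_recordSeq_succ {z : ℝ} (hz : 0 ≤ z) {f : (ℕ → ℝ) → ℝ≥0∞} (hf : Measurable f) :
    ∫⁻ w, f (fun i => recordSeq (consSeq z w) (i + 1)) ∂iidLaw (expMeasure 1) =
      ∫⁻ t, ∫⁻ w, f (recordSeq (consSeq (z + t) w)) ∂iidLaw (expMeasure 1) ∂expMeasure 1 := by
  have h : ∫⁻ w, f (fun i => recordSeq (consSeq z w) (i + 1)) ∂iidLaw (expMeasure 1) =
      ∫⁻ w, f (recordSeq (nextRecordShift (consSeq z w))) ∂iidLaw (expMeasure 1) := by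
    refine lintegral_congr_ae ?_
    filter_upwards [ae_exists_lt_of_expMeasure] with w hw
    congr 1
    funext i
    refine recordSeq_succ (fun i => ?_) _
    obtain ⟨j, hj, hj'⟩ := hw (consSeq z w i) i
    exact ⟨j + 1, Nat.lt_succ_of_le hj, hj'⟩
  have hm : Measurable fun x => f (recordSeq x) := by fun_prop
  rw [h, ← lintegral_map (g := fun w => nextRecordShift (consSeq z w)) hm (by fun_prop),
    map_nextRecordShift_consSeq hz, lintegral_map hm (by fun_prop),
    lintegral_prod _ (by fun_prop)]

lemma measurable_lintegral_recordSeq_consSeq {f : (ℕ → ℝ) → ℝ≥0∞} (hf : Measurable f) :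
    Measurable fun z => ∫⁻ w, f (recordSeq (consSeq z w)) ∂iidLaw (expMeasure 1) :=
  Measurable.lintegral_prod_right' (f := fun p : ℝ × (ℕ → ℝ) => f (recordSeq (consSeq p.1 p.2)))
    (by fun_prop)

/-- Markov property of the records of an exponential sequence: the increment over `k + 1` records
is gamma of shape `k + 1`, independent of the past. -/
lemma lintegral_recordSeq_add {z : ℝ} (hz : 0 ≤ z) (k : ℕ) {f : (ℕ → ℝ) → ℝ≥0∞}
    (hf : Measurable f) :
    ∫⁻ w, f (fun i => recordSeq (consSeq z w) (i + (k + 1))) ∂iidLaw (expMeasure 1) =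
      ∫⁻ t, ∫⁻ w, f (recordSeq (consSeq (z + t) w)) ∂iidLaw (expMeasure 1)
        ∂gammaMeasure ((k + 1 : ℕ) : ℝ) 1 := by
  induction k generalizing f with
  | zero => simpa [expMeasure] using lintegral_recordSeq_succ hz hf
  | succ k ih =>
    -- Shifting the test function by one index leaves a single exponential step to be taken from `z
    -- + t`.
    have h := ih (f := fun y => f fun i => y (i + 1)) (by fun_prop)
    simp only [add_assoc, add_comm 1] at h ⊢
    have hcast : ((k + (1 + 1) : ℕ) : ℝ) = ((k + 1 : ℕ) : ℝ) + 1 := by push_cast; ring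
    rw [h, hcast, ← lintegral_gammaMeasure_add_right
      (g := fun t => ∫⁻ w, f (recordSeq (consSeq (z + t) w)) ∂iidLaw (expMeasure 1))
      (by positivity) one_pos one_pos
      ((measurable_lintegral_recordSeq_consSeq hf).comp (measurable_const_add z))]
    refine lintegral_congr_ae ?_
    filter_upwards [ae_gammaMeasure_pos _ _] with t ht
    rw [lintegral_recordSeq_succ (by positivity) hf, expMeasure]
    simp [add_assoc]

/-- Record `0` is the first observation, itself exponential, so record `k` is a sum of `k + 1`
exponentials. -/
lemma lintegral_recordSeq_iidLaw (k : ℕ) {f : (ℕ → ℝ) → ℝ≥0∞} (hf : Measurable f) :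
    ∫⁻ x, f (fun i => recordSeq x (i + k)) ∂iidLaw (expMeasure 1) =
      ∫⁻ t, ∫⁻ w, f (recordSeq (consSeq t w)) ∂iidLaw (expMeasure 1)
        ∂gammaMeasure ((k + 1 : ℕ) : ℝ) 1 := by
  rw [lintegral_iidLaw_cons _ (by fun_prop)]
  cases k with
  | zero => simp [expMeasure]
  | succ k =>
    rw [add_comm (k + 1) 1, Nat.cast_add 1, Nat.cast_one,
      ← lintegral_gammaMeasure_add_right one_pos (by positivity) one_pos
      (measurable_lintegral_recordSeq_consSeq hf)]
    rw [expMeasure]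
    refine lintegral_congr_ae ?_
    filter_upwards [ae_gammaMeasure_pos _ _] with t ht
    exact lintegral_recordSeq_add ht.le k hf

/-- Joint law of three records of an exponential sequence. -/
lemma lintegral_three_records {i k r : ℕ} (hk : 1 ≤ k) (hr : 1 ≤ r)
    {g : ℝ × ℝ × ℝ → ℝ≥0∞} (hg : Measurable g) :
    ∫⁻ x, g (recordSeq x i, recordSeq x (i + k), recordSeq x (i + k + r)) ∂iidLaw (expMeasure 1) =
      ∫⁻ a, ∫⁻ T, ∫⁻ u, g (a, a + T * u, a + T) ∂betaMeasure k r
        ∂gammaMeasure ((k : ℝ) + r) 1 ∂gammaMeasure ((i + 1 : ℕ) : ℝ) 1 := by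
  obtain ⟨k, rfl⟩ := Nat.exists_eq_add_of_le' hk
  obtain ⟨r, rfl⟩ := Nat.exists_eq_add_of_le' hr
  have h := lintegral_recordSeq_iidLaw i (f := fun y => g (y 0, y (k + 1), y (k + 1 + (r + 1))))
    (by fun_prop)
  simp only [zero_add] at h
  have e1 : i + (k + 1) = k + 1 + i := by ring
  have e2 : i + (k + 1) + (r + 1) = k + 1 + (r + 1) + i := by ring
  rw [e2, e1, h]
  refine lintegral_congr_ae ?_
  filter_upwards [ae_gammaMeasure_pos _ _] with a ha
  have h2 := lintegral_recordSeq_add ha.le k (f := fun y => g (a, y 0, y (r + 1))) (by fun_prop)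
  simp only [add_comm _ (k + 1)] at h2
  simp only [recordSeq_zero, consSeq_zero]
  rw [h2]
  rw [← lintegral_gammaMeasure_add (g := fun s T => g (a, a + s, a + T)) (by positivity)
    (by positivity) one_pos (by simp only [Function.uncurry_def]; fun_prop)]
  refine lintegral_congr_ae ?_
  filter_upwards [ae_gammaMeasure_pos _ _] with s hs
  have h3 := lintegral_recordSeq_add (add_pos ha hs).le r (f := fun y => g (a, a + s, y 0))
    (by fun_prop)
  simp only [zero_add] at h3
  simp only [recordSeq_zero, consSeq_zero]
  rw [h3]
  simp [add_assoc]

/-! ### Quantile transform -/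

/-- The quantile of order `1 - exp (-s)` of `ν`. -/
noncomputable def expQuantile (ν : Measure ℝ) (s : ℝ) : ℝ :=
  sInf {x : ℝ | 1 - Real.exp (-s) ≤ cdf ν x}

/-- The cumulative hazard `-log (1 - F)` of `ν`. -/
noncomputable def cumHazard (ν : Measure ℝ) (x : ℝ) : ℝ := -Real.log (1 - cdf ν x)

section Quantile

variable {ν : Measure ℝ}

lemma measurable_cumHazard : Measurable (cumHazard ν) :=
  (Real.measurable_log.comp (measurable_const.sub (monotone_cdf ν).measurable)).neg

lemma exists_cdf_eq (hc : Continuous (cdf ν)) {p : ℝ} (h0 : 0 < p) (h1 : p < 1) :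
    ∃ x, cdf ν x = p :=
  mem_range_of_exists_le_of_exists_ge hc
    (((tendsto_cdf_atBot ν).eventually_le_const h0).exists)
    (((tendsto_cdf_atTop ν).eventually_const_le h1).exists)

lemma one_sub_exp_neg_pos {s : ℝ} (hs : 0 < s) : 0 < 1 - Real.exp (-s) := by
  simpa using hs

lemma one_sub_exp_neg_lt_one (s : ℝ) : 1 - Real.exp (-s) < 1 := by
  linarith [Real.exp_pos (-s)]

lemma bddBelow_le_cdf {p : ℝ} (h0 : 0 < p) : BddBelow {x : ℝ | p ≤ cdf ν x} := by
  obtain ⟨y, hy⟩ := ((tendsto_cdf_atBot ν).eventually_lt_const h0).exists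
  exact ⟨y, fun x hx => not_lt.1 fun h => (hx.trans (monotone_cdf ν h.le)).not_gt hy⟩

lemma cdf_expQuantile (hc : Continuous (cdf ν)) {s : ℝ} (hs : 0 < s) :
    cdf ν (expQuantile ν s) = 1 - Real.exp (-s) := by
  have h0 := one_sub_exp_neg_pos hs
  obtain ⟨y, hy⟩ := exists_cdf_eq hc h0 (one_sub_exp_neg_lt_one s)
  refine le_antisymm ?_ ?_
  · rw [← hy]
    exact monotone_cdf ν (csInf_le (bddBelow_le_cdf h0) hy.ge)
  · exact (isClosed_le continuous_const hc).csInf_mem ⟨y, hy.ge⟩ (bddBelow_le_cdf h0)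

lemma expQuantile_le_iff (hc : Continuous (cdf ν)) {s : ℝ} (hs : 0 < s) (x : ℝ) :
    expQuantile ν s ≤ x ↔ 1 - Real.exp (-s) ≤ cdf ν x :=
  ⟨fun h => (cdf_expQuantile hc hs).ge.trans (monotone_cdf ν h),
    fun h => csInf_le (bddBelow_le_cdf (one_sub_exp_neg_pos hs)) h⟩

/-- Here every real number qualifies, and `sInf` of the whole line is `0` by convention; only `s >
0` carries meaning. -/
lemma expQuantile_of_nonpos {s : ℝ} (hs : s ≤ 0) : expQuantile ν s = 0 := by
  have h : {x : ℝ | 1 - Real.exp (-s) ≤ cdf ν x} = Set.univ :=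
    Set.eq_univ_of_forall fun x => by
      have : 1 ≤ Real.exp (-s) := by simpa using hs
      exact le_trans (by linarith) (cdf_nonneg ν x)
  rw [expQuantile, h, Real.sInf_univ]

lemma strictMonoOn_expQuantile (hc : Continuous (cdf ν)) :
    StrictMonoOn (expQuantile ν) (Set.Ioi 0) := by
  intro s hs t ht hst
  refine (monotone_cdf ν).reflect_lt ?_
  rw [cdf_expQuantile hc hs, cdf_expQuantile hc ht]
  have : Real.exp (-t) < Real.exp (-s) := Real.exp_lt_exp.2 (by linarith)
  linarith

/-- A left inverse of the quantile: conditioning on record values of `X` is conditioning on the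
exponential records behind them. -/
lemma cumHazard_expQuantile (hc : Continuous (cdf ν)) {s : ℝ} (hs : 0 < s) :
    cumHazard ν (expQuantile ν s) = s := by
  simp [cumHazard, cdf_expQuantile hc hs]

lemma measurable_expQuantile (hc : Continuous (cdf ν)) : Measurable (expQuantile ν) := by
  refine measurable_of_Iic fun x => ?_
  have h : expQuantile ν ⁻¹' Set.Iic x =
      (Set.Ioi 0 ∩ {s | 1 - Real.exp (-s) ≤ cdf ν x}) ∪ (Set.Iic 0 ∩ {_s | 0 ≤ x}) := by
    ext s
    rcases lt_or_ge 0 s with hs | hs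
    · simp [hs, expQuantile_le_iff hc hs]
    · simp [hs.not_gt, hs, expQuantile_of_nonpos hs]
  rw [h]
  exact (measurableSet_Ioi.inter (measurableSet_le (by fun_prop) measurable_const)).union
    (measurableSet_Iic.inter (.const _))

lemma map_expQuantile [IsProbabilityMeasure ν] (hc : Continuous (cdf ν)) :
    (expMeasure 1).map (expQuantile ν) = ν := by
  refine Measure.ext_of_Iic _ _ fun x => ?_
  have h : expQuantile ν ⁻¹' Set.Iic x =ᵐ[expMeasure 1]
      {s | 1 - Real.exp (-s) ≤ cdf ν x} := by
    filter_upwards [ae_gammaMeasure_pos 1 1] with s hs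
    exact propext (expQuantile_le_iff hc hs x)
  rw [Measure.map_apply (measurable_expQuantile hc) measurableSet_Iic, measure_congr h,
    ← ofReal_cdf]
  -- Where `F x = 1` the logarithm below would be the default `log 0 = 0`.
  rcases (cdf_le_one ν x).lt_or_eq with h1 | h1
  · have h2 : {s | 1 - Real.exp (-s) ≤ cdf ν x} = Set.Iic (-Real.log (1 - cdf ν x)) := by
      ext s
      simp only [Set.mem_ofPred_eq, Set.mem_Iic]
      rw [le_neg, Real.log_le_iff_le_exp (by linarith)]
      constructor <;> intro h <;> linarith
    rw [h2, expMeasure_Iic, neg_neg, Real.exp_log (by linarith)]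
    · congr 1; ring
    · have := Real.log_nonpos (x := 1 - cdf ν x) (by linarith) (by linarith [cdf_nonneg ν x])
      linarith
  · have h2 : {s | 1 - Real.exp (-s) ≤ cdf ν x} = Set.univ :=
      Set.eq_univ_of_forall fun s => by rw [h1]; exact (one_sub_exp_neg_lt_one s).le
    rw [h2, h1, measure_univ, ENNReal.ofReal_one]

lemma leftExtremity_lt_expQuantile (hc : Continuous (cdf ν)) {s : ℝ} (hs : 0 < s) :
    leftExtremity ν < (expQuantile ν s : EReal) := by
  have h2 : (0 : ℝ) < s / 2 := by positivity
  refine lt_of_le_of_lt (sInf_le ⟨_, rfl, ?_⟩)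
    (EReal.coe_lt_coe (strictMonoOn_expQuantile hc h2 hs (by linarith)))
  rw [cdf_expQuantile hc h2]
  exact one_sub_exp_neg_pos h2

lemma expQuantile_lt_rightExtremity (hc : Continuous (cdf ν)) {s : ℝ} (hs : 0 < s) :
    (expQuantile ν s : EReal) < rightExtremity ν := by
  have h2 : (0 : ℝ) < s + 1 := by positivity
  refine lt_of_lt_of_le (EReal.coe_lt_coe (strictMonoOn_expQuantile hc hs h2 (by linarith)))
    (le_sSup ⟨_, rfl, ?_⟩)
  rw [cdf_expQuantile hc h2]
  exact one_sub_exp_neg_lt_one _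

/-- A continuous law is shifted exponential iff its quantile function `expQuantile` is affine. -/
lemma isShiftedExponential_iff (hc : Continuous (cdf ν)) :
    IsShiftedExponential ν ↔ ∃ α β : ℝ, ∀ s, 0 < s → expQuantile ν s = α + β * s := by
  constructor
  · rintro ⟨l, hl, -, c, hc0, hF⟩
    refine ⟨l, c⁻¹, fun s hs => ?_⟩
    have h1 := leftExtremity_lt_expQuantile hc hs
    rw [hl, EReal.coe_lt_coe_iff] at h1
    have h2 := hF _ h1.le
    rw [cdf_expQuantile hc hs, sub_right_inj, Real.exp_eq_exp] at h2
    field_simp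
    linarith
  · rintro ⟨α, β, h⟩
    have hβ : 0 < β := by
      have := strictMonoOn_expQuantile hc (a := 1) (b := 2) (by simp) (by simp) (by norm_num)
      rw [h 1 one_pos, h 2 two_pos] at this
      linarith
    have hgt : ∀ x, α < x → cdf ν x = 1 - Real.exp (-(x - α) / β) := by
      intro x hx
      have hs : 0 < (x - α) / β := div_pos (by linarith) hβ
      have h1 := cdf_expQuantile hc hs
      rw [h _ hs, mul_div_cancel₀ _ hβ.ne', add_sub_cancel] at h1
      rw [h1, neg_div]
    -- The quantile formula only covers points to the right of `α`; the value at `α` follows by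
    -- continuity.
    have hα : cdf ν α = 0 := by
      have h1 : Filter.Tendsto (cdf ν) (nhdsWithin α (Set.Ioi α)) (nhds (cdf ν α)) :=
        hc.continuousWithinAt
      have h2 : Filter.Tendsto (fun x => 1 - Real.exp (-(x - α) / β)) (nhdsWithin α (Set.Ioi α))
          (nhds (1 - Real.exp (-(α - α) / β))) :=
        Continuous.continuousWithinAt (by fun_prop)
      have h3 := tendsto_nhds_unique h1 (h2.congr' (by
        filter_upwards [self_mem_nhdsWithin] with x hx using (hgt x hx).symm))
      simpa using h3
    refine ⟨α, ?_, ?_, β⁻¹, inv_pos.2 hβ, fun x hx => ?_⟩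
    · refine le_antisymm ?_ ?_
      · refine le_of_forall_gt fun y hy => ?_
        obtain ⟨z, hz1, hz2⟩ := EReal.lt_iff_exists_real_btwn.1 hy
        refine lt_of_le_of_lt (sInf_le ⟨z, rfl, ?_⟩) hz2
        have hz := EReal.coe_lt_coe_iff.1 hz1
        rw [hgt z hz, neg_div]
        exact one_sub_exp_neg_pos (div_pos (by linarith) hβ)
      · refine le_sInf ?_
        rintro _ ⟨x, rfl, hx⟩
        refine EReal.coe_le_coe (not_lt.1 fun hlt => ?_)
        exact hx.not_ge (hα ▸ monotone_cdf ν hlt.le)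
    · refine top_unique (le_of_forall_lt fun y hy => ?_)
      obtain ⟨z, hz1, hz2⟩ := EReal.lt_iff_exists_real_btwn.1 hy
      have hm : α < max z (α + 1) := lt_max_of_lt_right (by linarith)
      refine hz1.trans_le ((EReal.coe_le_coe (le_max_left z (α + 1))).trans
        (le_sSup ⟨_, rfl, ?_⟩))
      rw [hgt _ hm, neg_div]
      exact one_sub_exp_neg_lt_one _
    · rcases hx.eq_or_lt with rfl | hx
      · simp [hα]
      · rw [hgt x hx]
        congr 2
        field_simp

end Quantile

/-! ### Conditional law of a record between two others -/

/-- No measurability of `P` is needed: `P (f x)` is carried to the image measure by `g`, and `f (g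
y) = y` almost everywhere there. -/
lemma ae_map_iff_of_ae_leftInverse {α β : Type*} [MeasurableSpace α] [MeasurableSpace β]
    [MeasurableEq β] {μ : Measure α} {f : α → β} {g : β → α} (hf : Measurable f)
    (hg : Measurable g) (h : ∀ᵐ x ∂μ, g (f x) = x) {P : β → Prop} :
    (∀ᵐ y ∂μ.map f, P y) ↔ ∀ᵐ x ∂μ, P (f x) := by
  refine ⟨ae_of_ae_map hf.aemeasurable, fun hP => ?_⟩
  have h1 : ∀ᵐ y ∂μ.map f, f (g y) = y := by
    have hs : MeasurableSet {y | f (g y) = y} := measurableSet_eq_fun (hf.comp hg) measurable_id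
    rw [ae_map_iff hf.aemeasurable hs]
    filter_upwards [h] with x hx
    rw [hx]
  have h2 : (μ.map f).map g = μ := by
    rw [Measure.map_map hg hf, Measure.map_congr (f := g ∘ f) (g := id) h, Measure.map_id]
  have h3 : ∀ᵐ y ∂μ.map f, P (f (g y)) := ae_of_ae_map hg.aemeasurable (by rwa [h2])
  filter_upwards [h1, h3] with y h1 h3
  rwa [h1] at h3

lemma recordTime_comp_of_strictMonoOn {Q : ℝ → ℝ} {s : Set ℝ} (hQ : StrictMonoOn Q s) {w : ℕ → ℝ}
    (hw : ∀ i, w i ∈ s) (m : ℕ) : recordTime (fun i => Q (w i)) m = recordTime w m := by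
  induction m with
  | zero => rfl
  | succ m ih =>
    rw [recordTime_succ, recordTime_succ, ih]
    simp only [hQ.lt_iff_lt (hw _) (hw _)]

/-- The density is positive exactly on `(0, ∞)`, up to the point `0`. -/
lemma ae_gammaMeasure_eq {a r : ℝ} (ha : 0 < a) (hr : 0 < r) :
    ae (gammaMeasure a r) = ae (volume.restrict (Set.Ioi (0 : ℝ))) := by
  ext s
  rw [← Filter.eventually_mem_set, ← Filter.eventually_mem_set, gammaMeasure,
    ae_withDensity_iff (by fun_prop), ae_restrict_iff' measurableSet_Ioi]
  refine Filter.eventually_congr ?_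
  filter_upwards [compl_mem_ae_iff.2 (measure_singleton (0 : ℝ))] with t ht
  refine imp_congr_left ?_
  rcases lt_or_gt_of_ne (show t ≠ 0 from ht) with h | h
  · simp [gammaPDF_of_neg h, h.le]
  · simp [gammaPDF, gammaPDFReal_pos ha hr h, h]

lemma ae_prod_gammaMeasure_iff {a b r : ℝ} (ha : 0 < a) (hb : 0 < b) (hr : 0 < r)
    {P : ℝ × ℝ → Prop} :
    (∀ᵐ p ∂(gammaMeasure a r).prod (gammaMeasure b r), P p) ↔
      ∀ᵐ p : ℝ × ℝ, 0 < p.1 → 0 < p.2 → P p := by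
  have := isProbabilityMeasure_gammaMeasure ha hr
  have := isProbabilityMeasure_gammaMeasure hb hr
  have h : ae ((gammaMeasure a r).prod (gammaMeasure b r)) =
      ae ((volume.restrict (Set.Ioi (0 : ℝ))).prod (volume.restrict (Set.Ioi (0 : ℝ)))) :=
    le_antisymm
      (Measure.AbsolutelyContinuous.prod (Measure.ae_le_iff_absolutelyContinuous.1
        (ae_gammaMeasure_eq ha hr).le) (Measure.ae_le_iff_absolutelyContinuous.1
        (ae_gammaMeasure_eq hb hr).le)).ae_le
      (Measure.AbsolutelyContinuous.prod (Measure.ae_le_iff_absolutelyContinuous.1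
        (ae_gammaMeasure_eq ha hr).ge) (Measure.ae_le_iff_absolutelyContinuous.1
        (ae_gammaMeasure_eq hb hr).ge)).ae_le
  rw [h, Measure.prod_restrict, ae_restrict_iff' (measurableSet_Ioi.prod measurableSet_Ioi)]
  simp only [Set.mem_prod, Set.mem_Ioi, and_imp]
  rfl

lemma ae_betaMeasure_mem_Ioo (a b : ℝ) : ∀ᵐ u ∂betaMeasure a b, u ∈ Set.Ioo (0 : ℝ) 1 := by
  rw [betaMeasure, ae_withDensity_iff (by fun_prop)]
  refine ae_of_all _ fun u hu => ?_
  by_contra h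
  rw [Set.mem_Ioo, not_and_or, not_lt, not_lt] at h
  rcases h with h | h
  · exact hu (betaPDF_eq_zero_of_nonpos h)
  · exact hu (betaPDF_eq_zero_of_one_le h)

lemma integrable_comp_betaMeasure {Q : ℝ → ℝ} (hQ : Measurable Q)
    (hmono : MonotoneOn Q (Set.Ioi 0)) {a T α β : ℝ} (ha : 0 < a) (hT : 0 < T) (hα : 0 < α)
    (hβ : 0 < β) : Integrable (fun u => Q (a + T * u)) (betaMeasure α β) := by
  have := isProbabilityMeasureBeta hα hβ
  refine Integrable.of_mem_Icc (Q a) (Q (a + T)) (by fun_prop) ?_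
  filter_upwards [ae_betaMeasure_mem_Ioo α β] with u hu
  have h1 : 0 < T * u := mul_pos hT hu.1
  have h2 : T * u < T := by nlinarith [hu.2]
  exact ⟨hmono (Set.mem_Ioi.2 ha) (Set.mem_Ioi.2 (by linarith)) (by linarith),
    hmono (Set.mem_Ioi.2 (by linarith)) (Set.mem_Ioi.2 (by linarith)) (by linarith)⟩

/-- Pushforward of a beta law by `Q` after rescaling it to the interval from `H u` to `H v`. -/
noncomputable def betaKernel (Q H : ℝ → ℝ) (a b : ℝ) : Kernel (ℝ × ℝ) ℝ :=
  (Kernel.id ×ₖ Kernel.const _ (betaMeasure a b)).map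
    fun q : (ℝ × ℝ) × ℝ => Q (H q.1.1 + (H q.1.2 - H q.1.1) * q.2)

lemma measurable_betaKernel_map {Q H : ℝ → ℝ} (hQ : Measurable Q) (hH : Measurable H) :
    Measurable fun q : (ℝ × ℝ) × ℝ =>
    Q (H q.1.1 + (H q.1.2 - H q.1.1) * q.2) := by fun_prop

lemma isMarkovKernel_betaKernel {Q H : ℝ → ℝ} (hQ : Measurable Q) (hH : Measurable H)
    {a b : ℝ} (ha : 0 < a) (hb : 0 < b) : IsMarkovKernel (betaKernel Q H a b) := by
  have := isProbabilityMeasureBeta ha hb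
  exact Kernel.IsMarkovKernel.map _ (measurable_betaKernel_map hQ hH)

lemma betaKernel_apply {Q H : ℝ → ℝ} (hQ : Measurable Q) (hH : Measurable H)
    {a b : ℝ} (ha : 0 < a) (hb : 0 < b) (p : ℝ × ℝ) :
    betaKernel Q H a b p =
      (betaMeasure a b).map fun u => Q (H p.1 + (H p.2 - H p.1) * u) := by
  have := isProbabilityMeasureBeta ha hb
  rw [betaKernel, Kernel.map_apply _ (measurable_betaKernel_map hQ hH), Kernel.prod_apply,
    Kernel.id_apply, Kernel.const_apply, Measure.dirac_prod,
    Measure.map_map (measurable_betaKernel_map hQ hH) (by fun_prop)]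
  rfl

section Records

variable {Ω : Type*} [MeasurableSpace Ω] {μ : Measure Ω} {X : ℕ → Ω → ℝ} {ν : Measure ℝ}

lemma aemeasurable_recordValue (hX : ∀ i, AEMeasurable (X i) μ) (n : ℕ) :
    AEMeasurable (recordValue X n) μ :=
  ((measurable_pi_apply (n - 1)).comp measurable_recordSeq).comp_aemeasurable
    (aemeasurable_pi_iff.2 hX)

variable [IsProbabilityMeasure ν]

/-- Joint law of three record values of a sequence of independent observations with a continuous
distribution function. -/
lemma lintegral_three_recordValues (hlaw : ∀ i, HasLaw (X i) ν μ) (hindep : iIndepFun X μ)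
    (hcont : Continuous (cdf ν)) {i k r : ℕ} (hi : 1 ≤ i) (hk : 1 ≤ k) (hr : 1 ≤ r)
    {g : ℝ × ℝ × ℝ → ℝ≥0∞} (hg : Measurable g) :
    ∫⁻ ω, g (recordValue X i ω, recordValue X (i + k) ω, recordValue X (i + k + r) ω) ∂μ =
      ∫⁻ a, ∫⁻ T, ∫⁻ u, g (expQuantile ν a, expQuantile ν (a + T * u), expQuantile ν (a + T))
        ∂betaMeasure k r ∂gammaMeasure ((k : ℝ) + r) 1 ∂gammaMeasure i 1 := by
  obtain ⟨i, rfl⟩ := Nat.exists_eq_add_of_le' hi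
  have hQ := measurable_expQuantile hcont
  have e1 : i + 1 + k - 1 = i + k := by omega
  have e2 : i + 1 + k + r - 1 = i + k + r := by omega
  set G : (ℕ → ℝ) → ℝ≥0∞ := fun x => g (recordSeq x i, recordSeq x (i + k),
    recordSeq x (i + k + r)) with hG
  have hGm : Measurable G := by fun_prop
  have h1 : ∫⁻ ω, g (recordValue X (i + 1) ω, recordValue X (i + 1 + k) ω,
      recordValue X (i + 1 + k + r) ω) ∂μ = ∫⁻ ω, G (fun j => X j ω) ∂μ := by
    simp only [recordValue, e1, e2, Nat.add_sub_cancel]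
    rfl
  have h2 : (iidLaw (expMeasure 1)).map (fun w j => expQuantile ν (w j)) = iidLaw ν := by
    rw [Measure.infinitePi_map_pi _ fun _ => hQ]
    congr 1
    funext
    exact map_expQuantile hcont
  have h3 : ∀ᵐ w ∂iidLaw (expMeasure 1), ∀ j, w j ∈ Set.Ioi (0 : ℝ) := by
    refine ae_all_iff.2 fun j => ?_
    have : ∀ᵐ t ∂(iidLaw (expMeasure 1)).map (fun w => w j), t ∈ Set.Ioi (0 : ℝ) := by
      rw [Measure.infinitePi_map_eval]
      exact ae_gammaMeasure_pos 1 1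
    exact ae_of_ae_map (measurable_pi_apply j).aemeasurable this
  have hlw := hindep.hasLaw_infinitePi hlaw
    (aemeasurable_pi_iff.2 fun j => (hlaw j).aemeasurable)
  rw [h1, ← lintegral_map' hGm.aemeasurable hlw.aemeasurable, hlw.map_eq]
  change ∫⁻ x, G x ∂iidLaw ν = _
  rw [← h2,
    lintegral_map hGm (by fun_prop), ← lintegral_three_records (g := fun p =>
      g (expQuantile ν p.1, expQuantile ν p.2.1, expQuantile ν p.2.2)) hk hr (by fun_prop)]
  refine lintegral_congr_ae ?_
  filter_upwards [h3] with w hw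
  simp only [hG, recordSeq, recordTime_comp_of_strictMonoOn (strictMonoOn_expQuantile hcont) hw]

lemma map_recordValue_pair (hlaw : ∀ i, HasLaw (X i) ν μ) (hindep : iIndepFun X μ)
    (hcont : Continuous (cdf ν)) {i k r : ℕ} (hi : 1 ≤ i) (hk : 1 ≤ k) (hr : 1 ≤ r) :
    μ.map (fun ω => (recordValue X i ω, recordValue X (i + k + r) ω)) =
      ((gammaMeasure i 1).prod (gammaMeasure ((k : ℝ) + r) 1)).map
        fun p => (expQuantile ν p.1, expQuantile ν (p.1 + p.2)) := by
  have hk0 : (0 : ℝ) < k := by exact_mod_cast hk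
  have hr0 : (0 : ℝ) < r := by exact_mod_cast hr
  have := isProbabilityMeasureBeta hk0 hr0
  have := isProbabilityMeasure_gammaMeasure (add_pos hk0 hr0) one_pos
  have hQ := measurable_expQuantile hcont
  have hm := aemeasurable_recordValue (μ := μ) (X := X) fun j => (hlaw j).aemeasurable
  refine Measure.ext_of_lintegral _ fun f hf => ?_
  rw [lintegral_map' hf.aemeasurable ((hm _).prodMk (hm _)), lintegral_map hf (by fun_prop),
    lintegral_prod _ (by fun_prop), lintegral_three_recordValues hlaw hindep hcont hi hk hr
      (g := fun p => f (p.1, p.2.2)) (by fun_prop)]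
  simp

variable [IsProbabilityMeasure μ]

/-- Regular conditional distributions are almost everywhere unique, so it suffices that `betaKernel`
disintegrates the joint law. It does, since `cumHazard` recovers `a` and `a + T` from their
quantiles. -/
lemma recordCondLaw_ae_eq (hlaw : ∀ i, HasLaw (X i) ν μ) (hindep : iIndepFun X μ)
    (hcont : Continuous (cdf ν)) {i k r : ℕ} (hi : 1 ≤ i) (hk : 1 ≤ k) (hr : 1 ≤ r) :
    recordCondLaw μ X (i + k) i (i + k + r)
      =ᵐ[μ.map (fun ω => (recordValue X i ω, recordValue X (i + k + r) ω))]
      betaKernel (expQuantile ν) (cumHazard ν) k r := by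
  have hk0 : (0 : ℝ) < k := by exact_mod_cast hk
  have hr0 : (0 : ℝ) < r := by exact_mod_cast hr
  have := isProbabilityMeasureBeta hk0 hr0
  have hi0 : (0 : ℝ) < i := by exact_mod_cast hi
  have := isProbabilityMeasure_gammaMeasure (add_pos hk0 hr0) one_pos
  have := isProbabilityMeasure_gammaMeasure hi0 one_pos
  have hQ := measurable_expQuantile hcont
  have hH := measurable_cumHazard (ν := ν)
  have hm := aemeasurable_recordValue (μ := μ) (X := X) fun j => (hlaw j).aemeasurable
  have := isMarkovKernel_betaKernel hQ hH hk0 hr0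
  refine condDistrib_ae_eq_of_measure_eq_compProd _ (hm _) ?_
  refine Measure.ext_of_lintegral _ fun f hf => ?_
  rw [lintegral_map' hf.aemeasurable (((hm _).prodMk (hm _)).prodMk (hm _)),
    Measure.lintegral_compProd hf, map_recordValue_pair hlaw hindep hcont hi hk hr,
    lintegral_map hf.lintegral_kernel_prod_right' (by fun_prop),
    lintegral_prod _ (by
      exact (hf.lintegral_kernel_prod_right'.comp (by fun_prop)).aemeasurable),
    lintegral_three_recordValues hlaw hindep hcont hi hk hr
      (g := fun p => f ((p.1, p.2.2), p.2.1)) (by fun_prop)]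
  refine lintegral_congr_ae ?_
  filter_upwards [ae_gammaMeasure_pos _ _] with a ha
  refine lintegral_congr_ae ?_
  filter_upwards [ae_gammaMeasure_pos _ _] with T hT
  rw [betaKernel_apply hQ hH hk0 hr0, lintegral_map (by fun_prop) (by fun_prop)]
  simp [cumHazard_expQuantile hcont ha, cumHazard_expQuantile hcont (add_pos ha hT)]

/-- The regression condition on record values as a functional equation for the quantile
function. -/
lemma recordRegression_iff (hlaw : ∀ i, HasLaw (X i) ν μ) (hindep : iIndepFun X μ)
    (hcont : Continuous (cdf ν)) {i k r : ℕ} (hi : 1 ≤ i) (hk : 1 ≤ k) (hr : 1 ≤ r)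
    (φ : ℝ → ℝ → ℝ) :
    RecordRegression μ X ν (i + k) i (i + k + r) φ ↔
      ∀ᵐ p : ℝ × ℝ, 0 < p.1 → 0 < p.2 →
        ∫ u, expQuantile ν (p.1 + p.2 * u) ∂betaMeasure k r =
          φ (expQuantile ν p.1) (expQuantile ν (p.1 + p.2)) := by
  have hk0 : (0 : ℝ) < k := by exact_mod_cast hk
  have hr0 : (0 : ℝ) < r := by exact_mod_cast hr
  have hi0 : (0 : ℝ) < i := by exact_mod_cast hi
  have := isProbabilityMeasure_gammaMeasure (add_pos hk0 hr0) one_pos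
  have := isProbabilityMeasure_gammaMeasure hi0 one_pos
  have hQ := measurable_expQuantile hcont
  have hH := measurable_cumHazard (ν := ν)
  have hpos : ∀ᵐ p ∂(gammaMeasure i 1).prod (gammaMeasure ((k : ℝ) + r) 1), 0 < p.1 ∧ 0 < p.2 :=
    (ae_prod_gammaMeasure_iff hi0 (add_pos hk0 hr0) one_pos).2
      (ae_of_all _ fun p h1 h2 => ⟨h1, h2⟩)
  have hker : ∀ {P : ℝ × ℝ → Measure ℝ → Prop},
      (∀ᵐ p ∂(μ.map (fun ω => (recordValue X i ω, recordValue X (i + k + r) ω))),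
        P p (recordCondLaw μ X (i + k) i (i + k + r) p)) ↔
      ∀ᵐ p ∂(μ.map (fun ω => (recordValue X i ω, recordValue X (i + k + r) ω))),
        P p (betaKernel (expQuantile ν) (cumHazard ν) k r p) := by
    intro P
    refine Filter.eventually_congr ?_
    filter_upwards [recordCondLaw_ae_eq hlaw hindep hcont hi hk hr] with p hp
    rw [hp]
  rw [RecordRegression, hker (P := fun p m => leftExtremity ν < (p.1 : EReal) → p.1 < p.2 →
      (p.2 : EReal) < rightExtremity ν → Integrable (fun t : ℝ => t) m ∧ ∫ t, t ∂m = φ p.1 p.2),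
    map_recordValue_pair hlaw hindep hcont hi hk hr,
    ae_map_iff_of_ae_leftInverse
      (g := fun q => (cumHazard ν q.1, cumHazard ν q.2 - cumHazard ν q.1))
      (by fun_prop) (by fun_prop) (by
        filter_upwards [hpos] with p hp
        simp [cumHazard_expQuantile hcont hp.1,
          cumHazard_expQuantile hcont (add_pos hp.1 hp.2)]),
    ← ae_prod_gammaMeasure_iff hi0 (add_pos hk0 hr0) one_pos]
  refine Filter.eventually_congr ?_
  filter_upwards [hpos] with p hp
  obtain ⟨h1, h2⟩ := hp
  have h12 := add_pos h1 h2
  have hint := integrable_comp_betaMeasure hQ (strictMonoOn_expQuantile hcont).monotoneOn h1 h2 hk0 hr0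
  have hm : Measurable fun u => expQuantile ν (p.1 + p.2 * u) := by fun_prop
  rw [betaKernel_apply hQ hH hk0 hr0]
  simp only [cumHazard_expQuantile hcont h1, cumHazard_expQuantile hcont h12,
    add_sub_cancel_left]
  rw [integral_map hm.aemeasurable (f := fun t => t) aestronglyMeasurable_id]
  constructor
  · intro h
    -- The restrictions `l < u < v < r` hold automatically for quantiles of positive arguments.
    exact (h (leftExtremity_lt_expQuantile hcont h1)
      (strictMonoOn_expQuantile hcont h1 h12 (by linarith))
      (expQuantile_lt_rightExtremity hcont h12)).2
  · intro h _ _ _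
    refine ⟨?_, h⟩
    exact (integrable_map_measure aestronglyMeasurable_id hm.aemeasurable).2 hint

end Records

/-! ### Functional equation for the quantile function -/

lemma exists_mem_Ioo_of_ae {P : ℝ → Prop} (h : ∀ᵐ x, P x) {a b : ℝ} (hab : a < b) :
    ∃ x ∈ Set.Ioo a b, P x := by
  by_contra hcon
  push Not at hcon
  have h0 : volume (Set.Ioo a b) = 0 := measure_mono_null (fun x hx => hcon x hx) h
  rw [Real.volume_Ioo, ENNReal.ofReal_eq_zero] at h0
  linarith

/-- Solutions of the integrated form of `t Ψ' = N Ψ` on `(0, b)` are multiples of `t ^ N`. -/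
lemma exists_eq_mul_pow_of_integral {b : ℝ} (N : ℕ) {ψ Ψ : ℝ → ℝ}
    (hψ : ∀ t ∈ Set.Ioo 0 b, IntervalIntegrable ψ volume 0 t)
    (hΨ : ∀ t ∈ Set.Ioo 0 b, Ψ t = ∫ s in (0 : ℝ)..t, ψ s)
    (hode : ∀ᵐ t, t ∈ Set.Ioo 0 b → t * ψ t = N * Ψ t) :
    ∃ C : ℝ, ∀ t ∈ Set.Ioo 0 b, Ψ t = C * t ^ N := by
  have hsub : ∀ {s t : ℝ}, s ∈ Set.Ioo 0 b → t ∈ Set.Ioo 0 b → Set.uIcc s t ⊆ Set.Ioo 0 b :=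
    fun hs ht => Set.OrdConnected.uIcc_subset Set.ordConnected_Ioo hs ht
  have hcont : ContinuousOn Ψ (Set.Ioo 0 b) := by
    intro t ht
    obtain ⟨c, hc1, hc2⟩ := exists_between ht.2
    have hc : c ∈ Set.Ioo 0 b := ⟨ht.1.trans hc1, hc2⟩
    have h1 := intervalIntegral.continuousOn_primitive_interval' (hψ c hc)
      (Set.left_mem_uIcc)
    rw [Set.uIcc_of_le hc.1.le] at h1
    have h2 : ContinuousAt (fun t => ∫ s in (0 : ℝ)..t, ψ s) t :=
      h1.continuousAt (Icc_mem_nhds ht.1 hc1)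
    refine (h2.congr ?_).continuousWithinAt
    filter_upwards [isOpen_Ioo.mem_nhds ht] with s hs using (hΨ s hs).symm
  have hchi : ContinuousOn (fun t => N * Ψ t / t) (Set.Ioo 0 b) :=
    (hcont.const_mul _).div continuousOn_id fun t ht => ht.1.ne'
  have hderiv : ∀ t ∈ Set.Ioo 0 b, HasDerivAt Ψ (N * Ψ t / t) t := by
    intro t ht
    have hint : ∀ s ∈ Set.Ioo 0 b, Ψ s = Ψ t + ∫ x in t..s, N * Ψ x / x := by
      intro s hs
      rw [hΨ s hs, hΨ t ht, ← intervalIntegral.integral_add_adjacent_intervals (hψ t ht)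
        ((hψ t ht).symm.trans (hψ s hs)), add_right_inj]
      refine intervalIntegral.integral_congr_ae ?_
      filter_upwards [hode] with x hx hxm
      have hx' := hsub ht hs (Set.uIoc_subset_uIcc hxm)
      rw [eq_div_iff hx'.1.ne', ← hx hx', mul_comm]
    have h1 : HasDerivAt (fun s => Ψ t + ∫ x in t..s, N * Ψ x / x) (N * Ψ t / t) t := by
      refine (intervalIntegral.integral_hasDerivAt_right (by simp) ?_ ?_).const_add _
      · exact hchi.stronglyMeasurableAtFilter isOpen_Ioo t ht
      · exact hchi.continuousAt (isOpen_Ioo.mem_nhds ht)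
    refine h1.congr_of_eventuallyEq ?_
    filter_upwards [isOpen_Ioo.mem_nhds ht] with s hs using hint s hs
  have hquot : ∀ t ∈ Set.Ioo 0 b, HasDerivAt (fun t => Ψ t / t ^ N) 0 t := by
    intro t ht
    have ht0 := ht.1.ne'
    have h1 := (hderiv t ht).div (hasDerivAt_pow N t) (pow_ne_zero _ ht0)
    have h0 : (N * Ψ t / t * t ^ N - Ψ t * (N * t ^ (N - 1))) / (t ^ N) ^ 2 = 0 := by
      rcases N with _ | N
      · simp
      · rw [Nat.add_sub_cancel, pow_succ]
        field_simp
        simp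
    rw [h0] at h1
    exact h1
  rcases (Set.Ioo 0 b).eq_empty_or_nonempty with h | ⟨t₀, ht₀⟩
  · exact ⟨0, fun t ht => absurd ht (by simp [h])⟩
  refine ⟨Ψ t₀ / t₀ ^ N, fun t ht => ?_⟩
  have hc := isOpen_Ioo.is_const_of_deriv_eq_zero isPreconnected_Ioo
    (fun t ht => (hquot t ht).differentiableAt.differentiableWithinAt)
    (fun t ht => (hquot t ht).deriv) ht ht₀
  rw [← hc, div_mul_cancel₀ _ (pow_ne_zero _ ht.1.ne')]

/-- If `g t` were off the line, a nearby good point on the appropriate side of `t` would contradict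
monotonicity. -/
lemma MonotoneOn.eq_mul_of_ae_eq_mul {g : ℝ → ℝ} {b c : ℝ} (hg : MonotoneOn g (Set.Ioo 0 b))
    (h : ∀ᵐ t, t ∈ Set.Ioo 0 b → g t = c * t) {t : ℝ} (ht : t ∈ Set.Ioo 0 b) : g t = c * t := by
  have hlim : Filter.Tendsto (fun s => c * s) (nhds t) (nhds (c * t)) :=
    Continuous.tendsto (by fun_prop) t
  refine le_antisymm (not_lt.1 fun hlt => ?_) (not_lt.1 fun hlt => ?_)
  · have h1 : {s | c * s < g t ∧ s ∈ Set.Ioo 0 b} ∈ nhds t :=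
      (hlim.eventually_lt_const hlt).and (isOpen_Ioo.mem_nhds ht)
    obtain ⟨l, u, hm, hsub⟩ := mem_nhds_iff_exists_Ioo_subset.1 h1
    obtain ⟨s, hs, hs'⟩ := exists_mem_Ioo_of_ae h hm.2
    obtain ⟨h2, h3⟩ := hsub ⟨hm.1.trans hs.1, hs.2⟩
    have := hg ht h3 hs.1.le
    rw [hs' h3] at this
    linarith
  · have h1 : {s | g t < c * s ∧ s ∈ Set.Ioo 0 b} ∈ nhds t :=
      (hlim.eventually_const_lt hlt).and (isOpen_Ioo.mem_nhds ht)
    obtain ⟨l, u, hm, hsub⟩ := mem_nhds_iff_exists_Ioo_subset.1 h1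
    obtain ⟨s, hs, hs'⟩ := exists_mem_Ioo_of_ae h hm.1
    obtain ⟨h2, h3⟩ := hsub ⟨hs.1, hs.2.trans hm.2⟩
    have := hg h3 ht hs.2.le
    rw [hs' h3] at this
    linarith

/-- Cauchy's formula: the primitive of `t ↦ ∫ (t - y) ^ m q y` is
`T ↦ ∫ (T - y) ^ (m + 1) q y / (m + 1)`. -/
lemma integral_integral_sub_pow_mul {q : ℝ → ℝ} {T : ℝ} (hT : 0 ≤ T) (m : ℕ)
    (hq : IntervalIntegrable q volume 0 T) :
    IntervalIntegrable (fun t => ∫ y in (0 : ℝ)..t, (t - y) ^ m * q y) volume 0 T ∧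
      ∫ y in (0 : ℝ)..T, (T - y) ^ (m + 1) * q y =
        ∫ t in (0 : ℝ)..T, (m + 1) * ∫ y in (0 : ℝ)..t, (t - y) ^ m * q y := by
  -- Fubini on the triangle `y < t`, the integrand being extended by zero to the square.
  set F : ℝ × ℝ → ℝ := {p : ℝ × ℝ | p.2 < p.1}.indicator (fun p => (p.1 - p.2) ^ m) with hF
  set ρ : Measure ℝ := volume.restrict (Set.Ioc 0 T) with hρ
  have hms : MeasurableSet {p : ℝ × ℝ | p.2 < p.1} := measurableSet_lt measurable_snd measurable_fst
  have hq' : Integrable q ρ := (intervalIntegrable_iff_integrableOn_Ioc_of_le hT).1 hq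
  have hint : Integrable (fun p : ℝ × ℝ => F p * q p.2) (ρ.prod ρ) := by
    refine Integrable.bdd_mul (c := T ^ m) (hq'.comp_snd ρ) ?_ ?_
    · exact (Measurable.indicator (by fun_prop) hms).aestronglyMeasurable
    · have h : ∀ᵐ p ∂ρ.prod ρ, p ∈ Set.Ioc 0 T ×ˢ Set.Ioc 0 T := by
        rw [hρ, Measure.prod_restrict]
        exact ae_restrict_mem (measurableSet_Ioc.prod measurableSet_Ioc)
      filter_upwards [h] with p hp
      obtain ⟨⟨h1, h2⟩, h3, h4⟩ := hp
      by_cases hlt : p.2 < p.1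
      · rw [hF, Set.indicator_of_mem (show p ∈ {p : ℝ × ℝ | p.2 < p.1} from hlt), Real.norm_eq_abs,
          abs_of_nonneg (pow_nonneg (by linarith) _)]
        exact pow_le_pow_left₀ (by linarith) (by linarith) _
      · rw [hF, Set.indicator_of_notMem (show p ∉ {p : ℝ × ℝ | p.2 < p.1} from hlt), norm_zero]
        positivity
  have hin : ∀ t ∈ Set.Ioc 0 T,
      ∫ y, F (t, y) * q y ∂ρ = ∫ y in (0 : ℝ)..t, (t - y) ^ m * q y := by
    intro t ht
    have h1 : (fun y => F (t, y) * q y) =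
        (Set.Iio t).indicator (fun y => (t - y) ^ m * q y) := by
      funext y
      by_cases h : y < t
      · rw [Set.indicator_of_mem (Set.mem_Iio.2 h), hF, Set.indicator_of_mem (by exact h)]
      · rw [Set.indicator_of_notMem (by simpa using h), hF, Set.indicator_of_notMem (by exact h),
          zero_mul]
    have h2 : Set.Ioc 0 T ∩ Set.Iio t = Set.Ioo 0 t := by
      ext y
      simp only [Set.mem_inter_iff, Set.mem_Ioc, Set.mem_Iio, Set.mem_Ioo]
      exact ⟨fun h => ⟨h.1.1, h.2⟩, fun h => ⟨⟨h.1, h.2.le.trans ht.2⟩, h.2⟩⟩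
    rw [h1, hρ, setIntegral_indicator measurableSet_Iio, h2,
      intervalIntegral.integral_of_le ht.1.le, integral_Ioc_eq_integral_Ioo]
  have hin' : ∀ y ∈ Set.Ioc 0 T,
      ∫ t, F (t, y) * q y ∂ρ = (T - y) ^ (m + 1) / (m + 1) * q y := by
    intro y hy
    rw [integral_mul_const]
    congr 1
    have h1 : (fun t => F (t, y)) = (Set.Ioi y).indicator (fun t => (t - y) ^ m) := by
      funext t
      by_cases h : y < t
      · rw [Set.indicator_of_mem (Set.mem_Ioi.2 h), hF, Set.indicator_of_mem (by exact h)]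
      · rw [Set.indicator_of_notMem (by simpa using h), hF, Set.indicator_of_notMem (by exact h)]
    have h2 : Set.Ioc 0 T ∩ Set.Ioi y = Set.Ioc y T := by
      ext t
      simp only [Set.mem_inter_iff, Set.mem_Ioc, Set.mem_Ioi]
      exact ⟨fun h => ⟨h.2, h.1.2⟩, fun h => ⟨⟨hy.1.trans h.1, h.2⟩, h.1⟩⟩
    rw [h1, hρ, setIntegral_indicator measurableSet_Ioi, h2,
      ← intervalIntegral.integral_of_le hy.2,
      intervalIntegral.integral_comp_sub_right (fun t => t ^ m) y, integral_pow]
    simp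
  have hJ : Integrable (fun t => ∫ y in (0 : ℝ)..t, (t - y) ^ m * q y) ρ := by
    refine hint.integral_prod_left.congr ?_
    filter_upwards [ae_restrict_mem measurableSet_Ioc] with t ht using hin t ht
  refine ⟨(intervalIntegrable_iff_integrableOn_Ioc_of_le hT).2 hJ, ?_⟩
  have hswap := integral_integral_swap (f := fun t y => F (t, y) * q y) hint
  have hl : ∫ t, ∫ y, F (t, y) * q y ∂ρ ∂ρ = ∫ t, (∫ y in (0 : ℝ)..t, (t - y) ^ m * q y) ∂ρ :=
    setIntegral_congr_fun measurableSet_Ioc hin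
  have hr : ∫ y, ∫ t, F (t, y) * q y ∂ρ ∂ρ = ∫ y, (T - y) ^ (m + 1) / (m + 1) * q y ∂ρ :=
    setIntegral_congr_fun measurableSet_Ioc hin'
  rw [hl, hr] at hswap
  rw [intervalIntegral.integral_const_mul, intervalIntegral.integral_of_le hT,
    intervalIntegral.integral_of_le hT, hswap, ← integral_const_mul]
  refine integral_congr_ae (ae_of_all _ fun y => ?_)
  have : (m : ℝ) + 1 ≠ 0 := by positivity
  field_simp

lemma beta_add_one_left {α β : ℝ} (hα : 0 < α) (hβ : 0 < β) :
    beta (α + 1) β = α / (α + β) * beta α β := by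
  have h : α + 1 + β = (α + β) + 1 := by ring
  have := (Real.Gamma_pos_of_pos (add_pos hα hβ)).ne'
  have := (add_pos hα hβ).ne'
  rw [beta, beta, h, Real.Gamma_add_one hα.ne', Real.Gamma_add_one this]
  field_simp

lemma integral_betaMeasure {α β : ℝ} (hα : 0 < α) (hβ : 0 < β) (f : ℝ → ℝ) :
    ∫ u, f u ∂betaMeasure α β = ∫ u, betaPDFReal α β u * f u := by
  rw [betaMeasure, integral_withDensity_eq_integral_toReal_smul (measurable_betaPDF α β)
    (ae_of_all _ fun u => ENNReal.ofReal_lt_top)]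
  refine integral_congr_ae (ae_of_all _ fun u => ?_)
  have h0 : 0 ≤ betaPDFReal α β u := by
    by_cases h : 0 < u ∧ u < 1
    · exact (betaPDFReal_pos h.1 h.2 hα hβ).le
    · rw [betaPDFReal, if_neg h]
  simp [betaPDF, ENNReal.toReal_ofReal h0]

lemma integral_id_betaMeasure {α β : ℝ} (hα : 0 < α) (hβ : 0 < β) :
    ∫ u, u ∂betaMeasure α β = α / (α + β) := by
  have hα' : 0 < α + 1 := by positivity
  have := isProbabilityMeasureBeta hα' hβ
  have h1 : ∫ _u, α / (α + β) ∂betaMeasure (α + 1) β = α / (α + β) := by simp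
  -- Multiplying the beta `(α, β)` density by `u` gives `α / (α + β)` times the beta `(α + 1, β)`
  -- density.
  rw [← h1, integral_betaMeasure hα hβ, integral_betaMeasure hα' hβ]
  refine integral_congr_ae (ae_of_all _ fun u => ?_)
  by_cases h : 0 < u ∧ u < 1
  · have hu : u ^ (α + 1 - 1) = u ^ (α - 1) * u := by
      rw [← Real.rpow_add_one h.1.ne']; congr 1; ring
    have := (beta_pos hα hβ).ne'
    have := (add_pos hα hβ).ne'
    simp only [betaPDFReal, if_pos h, hu, beta_add_one_left hα hβ]
    field_simp
  · simp [betaPDFReal, if_neg h]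

lemma integral_comp_mul_betaMeasure (k r : ℕ) {T : ℝ} (hT : 0 < T) (f : ℝ → ℝ) :
    ∫ u, f (T * u) ∂betaMeasure ((k + 1 : ℕ) : ℝ) ((r + 1 : ℕ) : ℝ) =
      (beta ((k + 1 : ℕ) : ℝ) ((r + 1 : ℕ) : ℝ) * T ^ (k + r + 1))⁻¹ *
        ∫ s in (0 : ℝ)..T, s ^ k * (T - s) ^ r * f s := by
  set B := beta ((k + 1 : ℕ) : ℝ) ((r + 1 : ℕ) : ℝ) with hB
  have h1 : ∫ u, f (T * u) ∂betaMeasure ((k + 1 : ℕ) : ℝ) ((r + 1 : ℕ) : ℝ) =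
      ∫ u in (0 : ℝ)..1, B⁻¹ * (u ^ k * (1 - u) ^ r * f (T * u)) := by
    rw [integral_betaMeasure (by positivity) (by positivity),
      intervalIntegral.integral_of_le zero_le_one, integral_Ioc_eq_integral_Ioo,
      ← integral_indicator measurableSet_Ioo]
    refine integral_congr_ae (ae_of_all _ fun u => ?_)
    by_cases h : 0 < u ∧ u < 1
    · simp only [betaPDFReal, if_pos h]
      rw [Set.indicator_of_mem (by exact h)]
      simp only [Nat.cast_add_one, add_sub_cancel_right, Real.rpow_natCast, hB]
      ring
    · simp only [betaPDFReal, if_neg h]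
      rw [Set.indicator_of_notMem (by exact h), zero_mul]
  have h2 := intervalIntegral.integral_comp_mul_left (a := 0) (b := 1)
    (fun s => s ^ k * (T - s) ^ r * f s) hT.ne'
  rw [mul_zero, mul_one, smul_eq_mul] at h2
  have h3 : ∫ s in (0 : ℝ)..T, s ^ k * (T - s) ^ r * f s =
      T * ∫ u in (0 : ℝ)..1, (T * u) ^ k * (T - T * u) ^ r * f (T * u) := by
    rw [h2]
    field_simp
  rw [h1, h3, intervalIntegral.integral_const_mul, ← mul_assoc]
  have h4 : ∫ u in (0 : ℝ)..1, (T * u) ^ k * (T - T * u) ^ r * f (T * u) =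
      T ^ (k + r) * ∫ u in (0 : ℝ)..1, u ^ k * (1 - u) ^ r * f (T * u) := by
    rw [← intervalIntegral.integral_const_mul]
    congr 1
    funext u
    have : T - T * u = T * (1 - u) := by ring
    rw [this, mul_pow, mul_pow, pow_add]
    ring
  have hB0 : B ≠ 0 := (beta_pos (by positivity) (by positivity)).ne'
  rw [h4, pow_succ]
  generalize ∫ u in (0 : ℝ)..1, u ^ k * (1 - u) ^ r * f (T * u) = I
  field_simp

/-- The values at `1` and `2` determine the coefficients, and every `s > 0` shares an interval with
both points. -/
lemma exists_affine_of_exists_affine_Ioo {Q : ℝ → ℝ}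
    (h : ∀ ε M : ℝ, 0 < ε → ∃ α β : ℝ, ∀ s ∈ Set.Ioo ε M, Q s = α + β * s) :
    ∃ α β : ℝ, ∀ s, 0 < s → Q s = α + β * s := by
  refine ⟨2 * Q 1 - Q 2, Q 2 - Q 1, fun s hs => ?_⟩
  obtain ⟨α, β, hαβ⟩ := h (min 1 s / 2) (max 2 s + 1) (by positivity)
  have h1 : min 1 s / 2 < 1 := by have := min_le_left 1 s; linarith
  have h2 : min 1 s / 2 < s := by have := min_le_right 1 s; linarith
  have h3 : 2 < max 2 s + 1 := by have := le_max_left 2 s; linarith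
  have h4 : s < max 2 s + 1 := by have := le_max_right 2 s; linarith
  rw [hαβ 1 ⟨h1, by linarith⟩, hαβ 2 ⟨by linarith, h3⟩, hαβ s ⟨h2, h4⟩]
  ring

lemma integral_affine_betaMeasure {Q : ℝ → ℝ} {α β : ℝ} (hQ : ∀ s, 0 < s → Q s = α + β * s)
    {a T k r : ℝ} (ha : 0 < a) (hT : 0 < T) (hk : 0 < k) (hr : 0 < r) :
    ∫ u, Q (a + T * u) ∂betaMeasure k r = (r * Q a + k * Q (a + T)) / (k + r) := by
  have := isProbabilityMeasureBeta hk hr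
  have h1 : ∫ u, Q (a + T * u) ∂betaMeasure k r =
      ∫ u, (α + β * a) + β * T * u ∂betaMeasure k r := by
    refine integral_congr_ae ?_
    filter_upwards [ae_betaMeasure_mem_Ioo k r] with u hu
    rw [hQ _ (add_pos ha (mul_pos hT hu.1))]
    ring
  have hint : Integrable (fun u : ℝ => u) (betaMeasure k r) := by
    refine Integrable.of_mem_Icc 0 1 (by fun_prop) ?_
    filter_upwards [ae_betaMeasure_mem_Ioo k r] with u hu using Set.Ioo_subset_Icc_self hu
  rw [h1, integral_add (integrable_const _) (hint.const_mul _), integral_const_mul,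
    integral_id_betaMeasure hk hr, hQ a ha, hQ _ (add_pos ha hT)]
  have := (add_pos hk hr).ne'
  simp
  field_simp
  ring

/-- Functional equation for the regression of a record on an earlier record and on its immediate
successor: its monotone solutions are affine. -/
lemma exists_affine_of_integral_eq_of_adjacent {Q : ℝ → ℝ} (hQ : Measurable Q)
    (hmono : MonotoneOn Q (Set.Ioi 0)) (k : ℕ)
    (h : ∀ᵐ p : ℝ × ℝ, 0 < p.1 → 0 < p.2 →
      ∫ u, Q (p.1 + p.2 * u) ∂betaMeasure ((k + 1 : ℕ) : ℝ) ((0 + 1 : ℕ) : ℝ) =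
        (Q p.1 + ((k + 1 : ℕ) : ℝ) * Q (p.1 + p.2)) / (((k + 1 : ℕ) : ℝ) + 1)) :
    ∃ α β : ℝ, ∀ s, 0 < s → Q s = α + β * s := by
  have hk1 : (0 : ℝ) < ((k + 1 : ℕ) : ℝ) := by positivity
  have h01 : (0 : ℝ) < ((0 + 1 : ℕ) : ℝ) := by positivity
  have hae := Measure.ae_ae_of_ae_prod h
  refine exists_affine_of_exists_affine_Ioo fun ε M hε => ?_
  -- A good left endpoint below `ε`, so that `a + t` with `0 < t < M` covers `(ε, M)`.
  obtain ⟨a, ⟨ha, haε⟩, hP⟩ := exists_mem_Ioo_of_ae hae hε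
  set g : ℝ → ℝ := fun t => Q (a + t) - Q a with hg
  have hgm : ∀ {s t}, 0 ≤ s → s ≤ t → g s ≤ g t := fun hs hst =>
    sub_le_sub_right (hmono (Set.mem_Ioi.2 (by linarith)) (Set.mem_Ioi.2 (by linarith))
      (by linarith)) _
  have hbeta : beta ((k + 1 : ℕ) : ℝ) ((0 + 1 : ℕ) : ℝ) = ((k + 1 : ℕ) : ℝ)⁻¹ := by
    have := (Real.Gamma_pos_of_pos hk1).ne'
    rw [beta, zero_add, Nat.cast_one, Real.Gamma_one, Real.Gamma_add_one hk1.ne']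
    field_simp
  have heq : ∀ᵐ t, t ∈ Set.Ioo 0 M →
      ∫ s in (0 : ℝ)..t, s ^ k * g s = t ^ (k + 1) * g t / ((k : ℝ) + 2) := by
    filter_upwards [hP] with t ht htM
    have := isProbabilityMeasureBeta hk1 h01
    have h1 := integral_comp_mul_betaMeasure k 0 htM.1 g
    have h2 := ht ha htM.1
    have hint := integrable_comp_betaMeasure hQ hmono ha htM.1 hk1 h01
    rw [hg, integral_sub hint (integrable_const _), h2, hbeta] at h1
    simp only [pow_zero, mul_one, add_zero, integral_const, probReal_univ, one_smul] at h1
    change _ = _ * ∫ s in (0 : ℝ)..t, s ^ k * g s at h1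
    have ht0 := htM.1.ne'
    push_cast at h1
    have hk1 : (k : ℝ) + 1 ≠ 0 := by positivity
    have hk2 : (k : ℝ) + 1 + 1 ≠ 0 := by positivity
    have hk3 : (k : ℝ) + 2 ≠ 0 := by positivity
    generalize ∫ s in (0 : ℝ)..t, s ^ k * g s = I at h1 ⊢
    simp only [hg]
    field_simp at h1 ⊢
    refine mul_left_cancel₀ hk1 ?_
    linear_combination -h1
  -- By `heq`, `t * ψ t = t ^ (k + 1) * g t = (k + 2) * Ψ t`.
  obtain ⟨C, hC⟩ := exists_eq_mul_pow_of_integral (b := M) (k + 2)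
    (ψ := fun s => s ^ k * g s) (Ψ := fun t => ∫ s in (0 : ℝ)..t, s ^ k * g s)
    (fun t ht => by
      refine IntervalIntegrable.continuousOn_mul ?_ (by fun_prop)
      refine MonotoneOn.intervalIntegrable fun x hx y hy hxy => hgm ?_ hxy
      rw [Set.uIcc_of_le ht.1.le] at hx
      exact hx.1)
    (fun t ht => rfl)
    (by
      filter_upwards [heq] with t ht htM
      rw [ht htM]
      have : (k : ℝ) + 2 ≠ 0 := by positivity
      push_cast
      field_simp
      ring)
  refine ⟨Q a - (k + 2) * C * a, (k + 2) * C, fun s hs => ?_⟩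
  have hlin := MonotoneOn.eq_mul_of_ae_eq_mul (g := g) (b := M) (c := (k + 2) * C)
    (fun x hx y hy hxy => hgm hx.1.le hxy)
    (by
      filter_upwards [heq] with t ht htM
      have h1 := hC t htM
      simp only [ht htM] at h1
      have ht0 := htM.1.ne'
      have : (k : ℝ) + 2 ≠ 0 := by positivity
      have h2 : t ^ (k + 2) = t ^ (k + 1) * t := pow_succ _ _
      rw [h2] at h1
      field_simp at h1
      linarith)
    (t := s - a) ⟨by linarith [hs.1], by linarith [hs.2]⟩
  simp only [hg, add_sub_cancel] at hlin
  linarith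

/-- Functional equations for the regressions of a record on two earlier records and on a later
record: their common monotone solutions are affine. -/
lemma exists_affine_of_integral_eq_of_integral_eq {Q : ℝ → ℝ} (hQ : Measurable Q)
    (hmono : MonotoneOn Q (Set.Ioi 0)) (m r : ℕ)
    (h₁ : ∀ᵐ p : ℝ × ℝ, 0 < p.1 → 0 < p.2 →
      ∫ u, Q (p.1 + p.2 * u) ∂betaMeasure ((m + 1 + 1 : ℕ) : ℝ) ((r + 1 : ℕ) : ℝ) =
        (((r + 1 : ℕ) : ℝ) * Q p.1 + ((m + 1 + 1 : ℕ) : ℝ) * Q (p.1 + p.2)) /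
          (((m + 1 + 1 : ℕ) : ℝ) + ((r + 1 : ℕ) : ℝ)))
    (h₂ : ∀ᵐ p : ℝ × ℝ, 0 < p.1 → 0 < p.2 →
      ∫ u, Q (p.1 + p.2 * u) ∂betaMeasure ((m + 1 : ℕ) : ℝ) ((r + 1 : ℕ) : ℝ) =
        (((r + 1 : ℕ) : ℝ) * Q p.1 + ((m + 1 : ℕ) : ℝ) * Q (p.1 + p.2)) /
          (((m + 1 : ℕ) : ℝ) + ((r + 1 : ℕ) : ℝ))) :
    ∃ α β : ℝ, ∀ s, 0 < s → Q s = α + β * s := by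
  -- The shear `(b, t) ↦ (b - t, t)` preserves Lebesgue measure, so the right endpoint `b` can be
  -- fixed instead of the left one.
  have hshear : ∀ {P : ℝ × ℝ → Prop}, (∀ᵐ p : ℝ × ℝ, P p) → ∀ᵐ b : ℝ, ∀ᵐ t : ℝ, P (b - t, t) :=
    fun hP => Measure.ae_ae_of_ae_prod
      ((measurePreserving_sub_prod (volume : Measure ℝ) (volume : Measure ℝ)).quasiMeasurePreserving.ae
        hP)
  refine exists_affine_of_exists_affine_Ioo fun ε M hε => ?_
  obtain ⟨b, ⟨hbM, -⟩, hP₁, hP₂⟩ := exists_mem_Ioo_of_ae ((hshear h₁).and (hshear h₂))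
    (lt_add_one (max M 0))
  have hb0 : 0 < b := (le_max_right _ _).trans_lt hbM
  have hbM : M < b := (le_max_left _ _).trans_lt hbM
  set p : ℝ → ℝ := fun y => Q b - Q (b - y) with hp
  have hpm : ∀ {s t}, s ≤ t → t < b → p s ≤ p t := fun hst ht =>
    sub_le_sub_left (hmono (Set.mem_Ioi.2 (by linarith)) (Set.mem_Ioi.2 (by linarith))
      (by linarith)) _
  -- Measured back from `b`, a regression evaluates the convolution of `y ^ r * p y` with the `j`-th
  -- power as a multiple of a power of `t` times `p t`.
  have hconv : ∀ (j : ℕ) {t : ℝ}, t ∈ Set.Ioo 0 b →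
      ∫ u, Q (b - t + t * u) ∂betaMeasure ((j + 1 : ℕ) : ℝ) ((r + 1 : ℕ) : ℝ) =
        (((r + 1 : ℕ) : ℝ) * Q (b - t) + ((j + 1 : ℕ) : ℝ) * Q (b - t + t)) /
          (((j + 1 : ℕ) : ℝ) + ((r + 1 : ℕ) : ℝ)) →
      ∫ y in (0 : ℝ)..t, (t - y) ^ j * (y ^ r * p y) =
        beta ((j + 1 : ℕ) : ℝ) ((r + 1 : ℕ) : ℝ) * t ^ (j + r + 1) *
          ((r + 1) * p t / (j + r + 2)) := by
    intro j t ht he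
    have hj : (0 : ℝ) < ((j + 1 : ℕ) : ℝ) := by positivity
    have hr : (0 : ℝ) < ((r + 1 : ℕ) : ℝ) := by positivity
    have := isProbabilityMeasureBeta hj hr
    have h1 := integral_comp_mul_betaMeasure j r ht.1 fun s => Q b - Q (b - t + s)
    have hint := integrable_comp_betaMeasure hQ hmono (sub_pos.2 ht.2) ht.1 hj hr
    rw [integral_sub (integrable_const _) hint, he] at h1
    have h2 : ∫ s in (0 : ℝ)..t, s ^ j * (t - s) ^ r * (Q b - Q (b - t + s)) =
        ∫ y in (0 : ℝ)..t, (t - y) ^ j * (y ^ r * p y) := by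
      have h3 := intervalIntegral.integral_comp_sub_left (a := 0) (b := t)
        (fun s => s ^ j * (t - s) ^ r * (Q b - Q (b - t + s))) t
      rw [sub_self, sub_zero] at h3
      rw [← h3]
      congr 1
      funext y
      have e1 : t - (t - y) = y := by ring
      have e2 : b - t + (t - y) = b - y := by ring
      rw [e1, e2, mul_assoc]
    have hB := (beta_pos hj hr).ne'
    have ht0 := ht.1.ne'
    rw [h2] at h1
    simp only [integral_const, probReal_univ, one_smul, sub_add_cancel] at h1
    generalize beta ((j + 1 : ℕ) : ℝ) ((r + 1 : ℕ) : ℝ) = B at h1 hB ⊢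
    generalize ∫ y in (0 : ℝ)..t, (t - y) ^ j * (y ^ r * p y) = I at h1 ⊢
    rw [← inv_mul_eq_iff_eq_mul₀ (mul_ne_zero hB (pow_ne_zero _ ht0)), ← h1, hp]
    have e : (j : ℝ) + r + 2 ≠ 0 := by positivity
    have e' : (j : ℝ) + 1 + (r + 1) ≠ 0 := by positivity
    push_cast
    field_simp
    ring
  have hq : ∀ t ∈ Set.Ioo 0 b, IntervalIntegrable (fun y => y ^ r * p y) volume 0 t := by
    intro t ht
    refine IntervalIntegrable.continuousOn_mul ?_ (by fun_prop)
    refine MonotoneOn.intervalIntegrable fun x hx y hy hxy => hpm hxy ?_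
    rw [Set.uIcc_of_le ht.1.le] at hy
    exact hy.2.trans_lt ht.2
  have hm1 : (0 : ℝ) < ((m + 1 : ℕ) : ℝ) := by positivity
  have hr1 : (0 : ℝ) < ((r + 1 : ℕ) : ℝ) := by positivity
  have hbeta : beta ((m + 1 + 1 : ℕ) : ℝ) ((r + 1 : ℕ) : ℝ) =
      (m + 1) / (m + r + 2) * beta ((m + 1 : ℕ) : ℝ) ((r + 1 : ℕ) : ℝ) := by
    rw [Nat.cast_add_one (m + 1), beta_add_one_left hm1 hr1]
    push_cast
    congr 2
    ring
  have hB : 0 < beta ((m + 1 : ℕ) : ℝ) ((r + 1 : ℕ) : ℝ) := beta_pos hm1 hr1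
  -- Cauchy's formula makes the convolution with exponent `m + 1` a primitive of `m + 1` times the
  -- one with exponent `m`. Dividing the two evaluations `hconv` eliminates `p` and leaves the
  -- exponent `m + r + 3`.
  obtain ⟨C, hC⟩ := exists_eq_mul_pow_of_integral (b := b) (m + r + 3)
    (ψ := fun t => (m + 1) * ∫ y in (0 : ℝ)..t, (t - y) ^ m * (y ^ r * p y))
    (Ψ := fun t => ∫ y in (0 : ℝ)..t, (t - y) ^ (m + 1) * (y ^ r * p y))
    (fun t ht => (integral_integral_sub_pow_mul ht.1.le m (hq t ht)).1.const_mul _)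
    (fun t ht => (integral_integral_sub_pow_mul ht.1.le m (hq t ht)).2)
    (by
      filter_upwards [hP₁, hP₂] with t ht₁ ht₂ ht
      rw [hconv m ht (ht₂ (sub_pos.2 ht.2) ht.1), hconv (m + 1) ht (ht₁ (sub_pos.2 ht.2) ht.1),
        hbeta]
      have e : (m : ℝ) + r + 2 ≠ 0 := by positivity
      have e' : (m : ℝ) + 1 + r + 2 ≠ 0 := by positivity
      have e2 : t ^ (m + 1 + r + 1) = t ^ (m + r + 1) * t := by rw [← pow_succ]; congr 1; ring
      rw [e2]
      push_cast
      field_simp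
      ring)
  set B := beta ((m + 1 + 1 : ℕ) : ℝ) ((r + 1 : ℕ) : ℝ) with hBdef
  have hB0 : B ≠ 0 := by rw [hbeta]; positivity
  have hr0 : (r : ℝ) + 1 ≠ 0 := by positivity
  set c : ℝ := (m + r + 3) * C / (B * (r + 1)) with hc
  refine ⟨Q b - c * b, c, fun s hs => ?_⟩
  have hlin := MonotoneOn.eq_mul_of_ae_eq_mul (g := p) (b := b) (c := c)
    (fun x hx y hy hxy => hpm hxy hy.2)
    (by
      filter_upwards [hP₁] with t ht₁ ht
      have h1 := hC t ht
      simp only [hconv (m + 1) ht (ht₁ (sub_pos.2 ht.2) ht.1)] at h1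
      have ht0 := ht.1.ne'
      have e' : (m : ℝ) + 1 + r + 2 ≠ 0 := by positivity
      have e2 : t ^ (m + r + 3) = t ^ (m + 1 + r + 1) * t := by rw [← pow_succ]; congr 1; ring
      rw [e2, ← hBdef] at h1
      rw [hc]
      push_cast at h1
      field_simp at h1 ⊢
      linarith)
    (t := b - s) ⟨by linarith [hs.2], by linarith [hs.1]⟩
  simp only [hp, sub_sub_cancel] at hlin
  linarith

theorem theorem2 {Ω : Type*} [MeasurableSpace Ω] (μ : Measure Ω) [IsProbabilityMeasure μ]
    (X : ℕ → Ω → ℝ) (ν : Measure ℝ) [IsProbabilityMeasure ν]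
    (hlaw : ∀ i, HasLaw (X i) ν μ) (hindep : iIndepFun X μ) (hcont : Continuous (cdf ν))
    (n : ℕ) :
    (∀ k : ℕ, 1 ≤ k → k ≤ n - 1 →
      (RecordRegression μ X ν n (n - k) (n + 1)
          (fun u v => (u + (k : ℝ) * v) / ((k : ℝ) + 1)) ↔
        IsShiftedExponential ν)) ∧
    (∀ r k : ℕ, 2 ≤ r → 2 ≤ k → k ≤ n - 1 →
      ((RecordRegression μ X ν n (n - k) (n + r)
            (fun u v => ((r : ℝ) * u + (k : ℝ) * v) / ((k : ℝ) + (r : ℝ))) ∧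
          RecordRegression μ X ν n (n - k + 1) (n + r)
            (fun u₂ v => ((r : ℝ) * u₂ + ((k : ℝ) - 1) * v) / ((r : ℝ) + (k : ℝ) - 1))) ↔
        IsShiftedExponential ν)) := by
  have hQ := measurable_expQuantile hcont
  have hmono := (strictMonoOn_expQuantile hcont).monotoneOn
  rw [isShiftedExponential_iff hcont]
  constructor
  · intro k hk hkn
    obtain ⟨k, rfl⟩ := Nat.exists_eq_add_of_le' hk
    obtain ⟨i, hi, rfl⟩ : ∃ i, 1 ≤ i ∧ n = i + (k + 1) := ⟨n - (k + 1), by omega, by omega⟩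
    rw [Nat.add_sub_cancel, recordRegression_iff hlaw hindep hcont hi hk le_rfl]
    refine ⟨exists_affine_of_integral_eq_of_adjacent hQ hmono k, ?_⟩
    rintro ⟨α, β, h⟩
    refine ae_of_all _ fun p h1 h2 => ?_
    rw [integral_affine_betaMeasure h h1 h2 (by positivity) (by positivity)]
    simp
  · intro r k hr hk hkn
    obtain ⟨m, rfl⟩ := Nat.exists_eq_add_of_le' hk
    obtain ⟨r, rfl⟩ := Nat.exists_eq_add_of_le' (one_le_two.trans hr)
    obtain ⟨i, hi, rfl⟩ : ∃ i, 1 ≤ i ∧ n = i + (m + 2) := ⟨n - (m + 2), by omega, by omega⟩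
    -- The second regression conditions on record `i + 1`, from which record `n` is one step closer.
    have e : i + (m + 2) = i + 1 + (m + 1) := by ring
    rw [Nat.add_sub_cancel, recordRegression_iff hlaw hindep hcont hi (by omega) (by omega), e,
      recordRegression_iff hlaw hindep hcont (by omega) (by omega) (by omega)]
    have e1 : ((m + 2 : ℕ) : ℝ) - 1 = ((m + 1 : ℕ) : ℝ) := by push_cast; ring
    have e2 : ((r + 1 : ℕ) : ℝ) + ((m + 2 : ℕ) : ℝ) - 1 =
        ((m + 1 : ℕ) : ℝ) + ((r + 1 : ℕ) : ℝ) := by push_cast; ring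
    simp only [e1, e2]
    constructor
    · rintro ⟨h₁, h₂⟩
      exact exists_affine_of_integral_eq_of_integral_eq hQ hmono m r h₁ h₂
    · rintro ⟨α, β, h⟩
      exact ⟨ae_of_all _ fun p h1 h2 =>
          integral_affine_betaMeasure h h1 h2 (by positivity) (by positivity),
        ae_of_all _ fun p h1 h2 =>
          integral_affine_betaMeasure h h1 h2 (by positivity) (by positivity)⟩
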